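/- Let $(\mathcal X,\mathfrak S,\mu)$ be a $\sigma$-finite measure space with an increasing sequence of $\sigma$-algebras $\mathfrak S_n\subset\mathfrak S_{n+1}\subset\mathfrak S$, $n\in\mathbb Z$. Assume that each $\mathfrak S_n$ is atomic: there is a countable disjoint collection $\mathscr D_n\subset\mathfrak S_n$ of sets of positive finite measure (atoms) such that every $A\in\mathfrak S_n$ is a union of sets from $\mathscr D_n$. Put $\mathscr D=\bigcup_{n}\mathscr D_n$, $|A|=\mu(A)$ and $\langle g\rangle_I=|I|^{-1}\int_I g\,d\mu$. For $I\in\mathscr D$ the collection $\operatorname{ch}(I)$ of its children consists of the $J\in\mathscr D_{n+1}$ with $J\subset I$, where $n$ is the largest integer with $I\in\mathscr D_n$; if $I\in\mathscr D_n$ for all sufficiently large $n$, then $\operatorname{ch}(I)=\{I\}$. Let $$\Delta_I g=\sum_{J\in\operatorname{ch}(I)}\langle g\rangle_J\mathbf 1_J-\langle g\rangle_I\mathbf 1_I ,\qquad \|g\|_{L^1(I)}=|I|^{-1}\int_I|g|\,d\mu .$$ Let $u\ge 0$ be a weight, i.e. a measurable function with $\int_I u\,d\mu<\infty$ for all $I\in\mathscr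 D$. For $I\in\mathscr D$ put $$\mathbf u_I=\langle u\rangle_I,\qquad \mathbf u_I^*=\|u\|_{\Lambda_{\psi_0}(I)}=\int_0^1 u_I^{*}(s)\,d\psi_0(s)\in[0,\infty],\qquad \psi_0(s)=s\ln(e/s),$$ where $u_I^{*}(s)=\inf\{t\ge0:\ |I|^{-1}|\{x\in I:u(x)>t\}|\le s\}$ is the decreasing rearrangement of $u$ on the probability space $(I,|I|^{-1}\mu)$. Let $\alpha:[1,\infty)\to[0,\infty)$ be an increasing function such that $$C_\alpha:=\frac1{\alpha(1)}+\int_1^\infty\frac{dt}{t\,\alpha(t)}<\infty .$$ Then for every real- or complex-valued $f\in L^2(u)=L^2(\mathcal X,u\,d\mu)$ $$\sum_{I\in\mathscr D}\frac{\|\Delta_I(fu)\|_{L^1(I)}^2}{\alpha(\mathbf u_I^*/\mathbf u_I)\,\mathbf u_I^*}\,|I|\ \le\ 36\,C_\alpha\,\|f\|_{L^2(u)}^2 ,$$ where the term of an atom $I$ is understood as $0$ if $\mathbf u_I=0$ or $\mathbf u_I^*=\infty$. -/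

import Mathlib

open MeasureTheory Set
open scoped ENNReal NNReal

/-- A `ℤ`-indexed filtration of sub-σ-algebras on the measure space `(X, μ)` all of whose members
are atomic: the `n`-th σ-algebra comes with a countable disjoint collection `atoms n` of sets of
positive (and finite) measure such that each set of that σ-algebra is a union of such atoms. -/
structure AtomicFiltration {X : Type*} [mX : MeasurableSpace X] (μ : Measure X) where
  filtration : Filtration ℤ mX
  atoms : ℤ → Set (Set X)
  countable_atoms : ∀ n, (atoms n).Countable
  disjoint_atoms : ∀ n, (atoms n).PairwiseDisjoint id
  measurableSet_atoms : ∀ n, ∀ I ∈ atoms n, MeasurableSet[filtration n] I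
  measure_atoms_pos : ∀ n, ∀ I ∈ atoms n, 0 < μ I
  measure_atoms_lt_top : ∀ n, ∀ I ∈ atoms n, μ I < ∞
  exists_eq_sUnion : ∀ n, ∀ A : Set X, MeasurableSet[filtration n] A →
    ∃ T : Set (Set X), T ⊆ atoms n ∧ A = ⋃₀ T

namespace AtomicFiltration

variable {X : Type*} [MeasurableSpace X] {μ : Measure X}

/-- The collection of the atoms of all generations (an atom that belongs to several generations
is one element of it). -/
def allAtoms (D : AtomicFiltration μ) : Set (Set X) :=
  ⋃ n, D.atoms n

/-- The children of an atom `I`: if `n` is the last generation that contains `I`, they are the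
atoms of generation `n + 1` inside `I`; if `I` belongs to all sufficiently late generations, then
`I` is its own only child. -/
def children (D : AtomicFiltration μ) (I : Set X) : Set (Set X) :=
  {J | (∃ n, IsGreatest {k | I ∈ D.atoms k} n ∧ J ∈ D.atoms (n + 1) ∧ J ⊆ I) ∨
    ((∃ n, ∀ k, n ≤ k → I ∈ D.atoms k) ∧ J = I)}

/-- The martingale difference
`Δ_I g = ∑_{J a child of I} ⟨g⟩_J 1_J - ⟨g⟩_I 1_I`. -/
noncomputable def martingaleDiff {𝕜 : Type*} [RCLike 𝕜] (D : AtomicFiltration μ) (I : Set X)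
    (g : X → 𝕜) (x : X) : 𝕜 :=
  (∑' J : D.children I, (J : Set X).indicator (fun _ => ⨍ y in (J : Set X), g y ∂μ) x) -
    I.indicator (fun _ => ⨍ y in I, g y ∂μ) x

end AtomicFiltration

/-- The decreasing rearrangement `s ↦ inf {t ≥ 0 | N(t) ≤ s}` of a nonnegative function `u`,
where `N(t) = ν {u > t}` is its distribution function. -/
noncomputable def decreasingRearrangement {X : Type*} [MeasurableSpace X] (ν : Measure X)
    (u : X → ℝ≥0) (s : ℝ) : ℝ≥0∞ :=
  sInf {t : ℝ≥0∞ | ν {x | t < (u x : ℝ≥0∞)} ≤ ENNReal.ofReal s}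

/-- `ψ₀(s) = s ln (e / s)`, with `ψ₀(0) = 0`; it is used for `s ∈ [0, 1]`. -/
noncomputable def psiZero (s : ℝ) : ℝ :=
  s * Real.log (Real.exp 1 / s)

theorem psiZero_eq (s : ℝ) : psiZero s = s + Real.negMulLog s := by
  rcases eq_or_ne s 0 with rfl | hs
  · simp [psiZero]
  · rw [psiZero, Real.log_div (Real.exp_ne_zero 1) hs, Real.log_exp, Real.negMulLog]
    ring

theorem continuous_psiZero : Continuous psiZero := by
  have h : psiZero = fun s => s + Real.negMulLog s := funext psiZero_eq
  rw [h]
  exact continuous_id.add Real.continuous_negMulLog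

theorem monotoneOn_psiZero : MonotoneOn psiZero (Icc 0 1) := by
  apply monotoneOn_of_deriv_nonneg (convex_Icc 0 1) continuous_psiZero.continuousOn
  · intro x hx
    rw [interior_Icc] at hx
    have h : psiZero = fun s => s + Real.negMulLog s := funext psiZero_eq
    rw [h]
    exact (differentiableAt_id.add
      (Real.hasDerivAt_negMulLog hx.1.ne').differentiableAt).differentiableWithinAt
  · intro x hx
    rw [interior_Icc] at hx
    have h : psiZero = fun s => s + Real.negMulLog s := funext psiZero_eq
    have h2 : HasDerivAt psiZero (1 + (-Real.log x - 1)) x := by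
      rw [h]
      exact (hasDerivAt_id x).add (Real.hasDerivAt_negMulLog hx.1.ne')
    rw [h2.deriv]
    have := Real.log_nonpos hx.1.le hx.2.le
    linarith

/-- The function `ψ₀` on `[0, 1]`, extended to be constant outside, as a Stieltjes function; its
measure is `dψ₀`. -/
noncomputable def psiZeroStieltjes : StieltjesFunction ℝ where
  toFun s := psiZero (max 0 (min s 1))
  mono' := by
    intro a b hab
    exact monotoneOn_psiZero ⟨le_max_left _ _, max_le zero_le_one (min_le_right _ _)⟩
      ⟨le_max_left _ _, max_le zero_le_one (min_le_right _ _)⟩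
      (max_le_max le_rfl (min_le_min hab le_rfl))
  right_continuous' := by
    intro x
    have h : Continuous fun s : ℝ => psiZero (max 0 (min s 1)) :=
      continuous_psiZero.comp (continuous_const.max (continuous_id.min continuous_const))
    exact h.continuousWithinAt

/-- The Lorentz norm `‖u‖_{Λ_{ψ₀}} = ∫₀¹ u^*(s) dψ₀(s)` of a nonnegative function `u` on a
probability space; it may be infinite. -/
noncomputable def lorentzNorm {X : Type*} [MeasurableSpace X] (ν : Measure X)
    (u : X → ℝ≥0) : ℝ≥0∞ :=
  ∫⁻ s in Ioc 0 1, decreasingRearrangement ν u s ∂psiZeroStieltjes.measure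

/-- The entropy bump `α(‖u‖_{Λ_{ψ₀}} / ‖u‖_{L¹}) ‖u‖_{Λ_{ψ₀}}` of `u` on a probability space,
understood as `∞` when `‖u‖_{Λ_{ψ₀}} = ∞`. -/
noncomputable def entropyBump {X : Type*} [MeasurableSpace X] (α : ℝ → ℝ≥0) (ν : Measure X)
    (u : X → ℝ≥0) : ℝ≥0∞ :=
  open Classical in
  if lorentzNorm ν u = ∞ then ∞
  else (α (lorentzNorm ν u / ∫⁻ x, (u x : ℝ≥0∞) ∂ν).toReal : ℝ≥0∞) * lorentzNorm ν u

/-- `C_α = 1 / α(1) + ∫₁^∞ dt / (t α(t))`, with values in `[0, ∞]`. -/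
noncomputable def bumpConst (α : ℝ → ℝ≥0) : ℝ≥0∞ :=
  (α 1 : ℝ≥0∞)⁻¹ + ∫⁻ t in Ioi (1 : ℝ), (ENNReal.ofReal t * (α t : ℝ≥0∞))⁻¹

/-! The proof is a Bellman function argument. Attach to an atom `I` the mean `x` of `fu`, the mean
`u` of the weight and its Lorentz norm `w`. With `C = C_α` put `g(r) = C + ∫₁^r dt/(tα(t))`, so that
`C ≤ g ≤ 2C`, then `v = u g(w/u)` and `B = 2C|x|²/u + 32C²|x|²/v`. The claim is that `B` at `I` plus
the term of `I` is at most the average of `B` over the cells of the next generation. Write `x_J −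
x_I = (x_J − u_J x_I/u_I) + (u_J − u_I) x_I/u_I`; the two parts are paid for by different halves of
`B`.

The function `|x|²/u` is jointly convex, and its remainder controls the first part
(`norm_integral_sq_div_add_le`). For the second part, layer cake gives `w = ∫ ψ₀(N(t)) dt` with `N`
the distribution function of the weight. The strict concavity of `ψ₀` makes the average of `w` drop
by at least `Δ²/(4u_I)`, where `Δ` is the average of `|u_J − u_I|`
(`lintegral_lorentzNorm_cell_add_le`). Since `tα(t)` increases, `g` is concave, so `v` drops by at
least `1/(rα(r))` times the drop of `w`, where `r = w_I/u_I` (`bumpDenom_le_add`). The drop of `v`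
is a gain in the average of `|x|²/v`. `bellman_arithmetic` balances the constants and
`ofReal_bellman_add_le` assembles the inequality.

Integrated over a whole generation, `B` thus grows with `n` by at least the terms of that
generation. It is nonnegative, and Cauchy–Schwarz bounds its integral by `36 C ‖f‖²`, so the
telescoping sum is bounded (`tsum_atomTerm_le`). -/

namespace AtomicFiltration

/-! ### Cells of a generation, normalized averages and the tower property -/

section Cells

variable {X : Type*} [MeasurableSpace X] {μ : Measure X} (D : AtomicFiltration μ)

theorem exists_mem_atoms_mem (n : ℤ) (y : X) : ∃ I ∈ D.atoms n, y ∈ I := by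
  obtain ⟨T, hT, hU⟩ := D.exists_eq_sUnion n univ MeasurableSet.univ
  obtain ⟨I, hI, hy⟩ := mem_sUnion.1 (hU ▸ mem_univ y)
  exact ⟨I, hT hI, hy⟩

/-- The atom of generation `n` that contains the point `y`. -/
noncomputable def cell (n : ℤ) (y : X) : Set X :=
  (D.exists_mem_atoms_mem n y).choose

theorem cell_mem_atoms (n : ℤ) (y : X) : D.cell n y ∈ D.atoms n :=
  (D.exists_mem_atoms_mem n y).choose_spec.1

theorem mem_cell (n : ℤ) (y : X) : y ∈ D.cell n y :=
  (D.exists_mem_atoms_mem n y).choose_spec.2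

variable {D}

theorem eq_of_mem_atoms {n : ℤ} {I J : Set X} (hI : I ∈ D.atoms n) (hJ : J ∈ D.atoms n) {y : X}
    (hyI : y ∈ I) (hyJ : y ∈ J) : I = J :=
  (D.disjoint_atoms n).elim_set hI hJ y hyI hyJ

theorem cell_eq_of_mem {n : ℤ} {I : Set X} (hI : I ∈ D.atoms n) {y : X} (hy : y ∈ I) :
    D.cell n y = I :=
  eq_of_mem_atoms (D.cell_mem_atoms n y) hI (D.mem_cell n y) hy

theorem measurableSet_of_mem_atoms {n : ℤ} {I : Set X} (hI : I ∈ D.atoms n) : MeasurableSet I :=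
  D.filtration.le n _ (D.measurableSet_atoms n I hI)

theorem nonempty_of_mem_atoms {n : ℤ} {I : Set X} (hI : I ∈ D.atoms n) : I.Nonempty :=
  nonempty_of_measure_ne_zero (D.measure_atoms_pos n I hI).ne'

theorem subset_or_disjoint {n m : ℤ} (hnm : n ≤ m) {I J : Set X} (hI : I ∈ D.atoms n)
    (hJ : J ∈ D.atoms m) : J ⊆ I ∨ Disjoint I J := by
  obtain ⟨T, hT, rfl⟩ := D.exists_eq_sUnion m I
    (D.filtration.mono hnm _ (D.measurableSet_atoms n I hI))
  by_cases h : J ∈ T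
  · exact Or.inl (subset_sUnion_of_mem h)
  · right
    rw [disjoint_sUnion_left]
    intro K hK
    exact D.disjoint_atoms m (hT hK) hJ fun e => h (e ▸ hK)

theorem cell_subset_of_mem {n m : ℤ} (hnm : n ≤ m) {I : Set X} (hI : I ∈ D.atoms n) {y : X}
    (hy : y ∈ I) : D.cell m y ⊆ I :=
  (subset_or_disjoint hnm hI (D.cell_mem_atoms m y)).resolve_right
    fun h => disjoint_left.1 h hy (D.mem_cell m y)

/-- Cells shrink with the generation, so a cell equal to `I` at both ends is squeezed in between:
the generations of an atom form an interval of `ℤ`. -/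
theorem mem_atoms_of_mem_of_mem {k l m : ℤ} (hkl : k ≤ l) (hlm : l ≤ m) {I : Set X}
    (hk : I ∈ D.atoms k) (hm : I ∈ D.atoms m) : I ∈ D.atoms l := by
  obtain ⟨y, hy⟩ := nonempty_of_mem_atoms hk
  have h1 : D.cell l y ⊆ I := cell_subset_of_mem hkl hk hy
  have h2 : I ⊆ D.cell l y := by
    have := cell_subset_of_mem hlm (D.cell_mem_atoms l y) (D.mem_cell l y)
    rwa [cell_eq_of_mem hm hy] at this
  rw [h2.antisymm h1]
  exact D.cell_mem_atoms l y

theorem children_eq_of_isGreatest {n : ℤ} {I : Set X}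
    (h : IsGreatest {k | I ∈ D.atoms k} n) :
    D.children I = {J | J ∈ D.atoms (n + 1) ∧ J ⊆ I} := by
  ext J
  constructor
  · rintro (⟨m, hm, hJ⟩ | ⟨⟨m, hm⟩, -⟩)
    · rwa [hm.unique h] at hJ
    · have : max m (n + 1) ≤ n := h.2 (hm _ (le_max_left _ _))
      have := le_max_right m (n + 1)
      omega
  · exact fun hJ => Or.inl ⟨n, h, hJ⟩

/-- Without a last generation the atom lies in arbitrarily late ones, hence in all late ones because
its generations form an interval. -/
theorem children_eq_of_not_bddAbove {I : Set X} (hI : I ∈ D.allAtoms)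
    (h : ¬ ∃ n, IsGreatest {k | I ∈ D.atoms k} n) : D.children I = {I} := by
  obtain ⟨n, hn⟩ := mem_iUnion.1 hI
  have hb : ∀ m : ℤ, ∃ k, m < k ∧ I ∈ D.atoms k := by
    by_contra! hm
    obtain ⟨m, hm⟩ := hm
    obtain ⟨b, hb, hb'⟩ := Int.exists_greatest_of_bdd (P := fun k => I ∈ D.atoms k)
      ⟨m, fun z hz => not_lt.1 fun hlt => hm z hlt hz⟩ ⟨n, hn⟩
    exact h ⟨b, hb, hb'⟩
  ext J
  constructor
  · rintro (⟨m, hm, -⟩ | ⟨-, hJ⟩)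
    · exact absurd ⟨m, hm⟩ h
    · exact hJ
  · intro hJ
    refine Or.inr ⟨⟨n, fun k hk => ?_⟩, hJ⟩
    obtain ⟨l, hl, hIl⟩ := hb k
    exact mem_atoms_of_mem_of_mem hk hl.le hn hIl

/-- The cell is constant on each of countably many measurable atoms. This lets sums over children be
written as integrals in `y` over a probability space. -/
theorem measurable_uncurry_cell {β γ : Type*} [MeasurableSpace β] [MeasurableSpace γ] (n : ℤ)
    {F : Set X → β → γ} (hF : ∀ J ∈ D.atoms n, Measurable (F J)) :
    Measurable fun p : X × β => F (D.cell n p.1) p.2 := by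
  intro s hs
  have : (fun p : X × β => F (D.cell n p.1) p.2) ⁻¹' s = ⋃ J ∈ D.atoms n, J ×ˢ (F J ⁻¹' s) := by
    ext ⟨y, b⟩
    simp only [mem_preimage, mem_iUnion, mem_prod, exists_prop]
    constructor
    · exact fun h => ⟨_, D.cell_mem_atoms n y, D.mem_cell n y, h⟩
    · rintro ⟨J, hJ, hy, h⟩
      rwa [cell_eq_of_mem hJ hy]
  rw [this]
  exact MeasurableSet.biUnion (D.countable_atoms n) fun J hJ =>
    (measurableSet_of_mem_atoms hJ).prod (hF J hJ hs)

theorem measurable_comp_cell {γ : Type*} [MeasurableSpace γ] (n : ℤ) (F : Set X → γ) :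
    Measurable fun y => F (D.cell n y) := by
  have h := measurable_uncurry_cell (D := D) (β := Unit) n (F := fun J _ => F J)
    fun _ _ => measurable_const
  exact h.comp (measurable_id.prodMk (measurable_const (a := ())))

theorem inter_iUnion_atoms (m : ℤ) (I : Set X) : ⋃ J : D.atoms m, I ∩ J = I := by
  ext y
  simp only [mem_iUnion, mem_inter_iff, exists_and_left, and_iff_left_iff_imp]
  exact fun _ => ⟨⟨_, D.cell_mem_atoms m y⟩, D.mem_cell m y⟩

theorem pairwise_disjoint_inter_atoms (m : ℤ) (I : Set X) :
    Pairwise (Function.onFun Disjoint fun J : D.atoms m => I ∩ (J : Set X)) := by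
  intro J K h
  exact (D.disjoint_atoms m J.2 K.2 fun e => h (Subtype.ext e)).mono inter_subset_right
    inter_subset_right

theorem setLIntegral_eq_tsum_atoms (m : ℤ) {I : Set X} (hI : MeasurableSet I) (h : X → ℝ≥0∞) :
    ∫⁻ y in I, h y ∂μ = ∑' J : D.atoms m, ∫⁻ y in I ∩ (J : Set X), h y ∂μ := by
  have : Countable (D.atoms m) := (D.countable_atoms m).to_subtype
  conv_lhs => rw [← inter_iUnion_atoms (D := D) m I]
  exact lintegral_iUnion (fun J => hI.inter (measurableSet_of_mem_atoms J.2))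
    (pairwise_disjoint_inter_atoms m I) _

theorem setLIntegral_comp_cell {m : ℤ} {J : Set X} (hJ : J ∈ D.atoms m) (F : Set X → ℝ≥0∞) :
    ∫⁻ y in J, F (D.cell m y) ∂μ = F J * μ J := by
  rw [setLIntegral_congr_fun (g := fun _ => F J) (measurableSet_of_mem_atoms hJ)
    fun y hy => by simp only [cell_eq_of_mem hJ hy]]
  simp

theorem lintegral_comp_cell (m : ℤ) (F : Set X → ℝ≥0∞) :
    ∫⁻ y, F (D.cell m y) ∂μ = ∑' J : D.atoms m, F J * μ (J : Set X) := by
  rw [← setLIntegral_univ, setLIntegral_eq_tsum_atoms (D := D) m .univ]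
  simp_rw [univ_inter]
  exact tsum_congr fun J => setLIntegral_comp_cell J.2 F

theorem lintegral_eq_tsum_atoms (m : ℤ) (h : X → ℝ≥0∞) :
    ∫⁻ y, h y ∂μ = ∑' J : D.atoms m, ∫⁻ y in (J : Set X), h y ∂μ := by
  rw [← setLIntegral_univ, setLIntegral_eq_tsum_atoms (D := D) m .univ]
  simp_rw [univ_inter]

theorem lintegral_cond_eq {I : Set X} (h : X → ℝ≥0∞) :
    ∫⁻ y, h y ∂(ProbabilityTheory.cond μ I) = (μ I)⁻¹ * ∫⁻ y in I, h y ∂μ := by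
  rw [ProbabilityTheory.cond, lintegral_smul_measure, smul_eq_mul]

theorem integral_cond_eq {E : Type*} [NormedAddCommGroup E] [NormedSpace ℝ E] {I : Set X}
    (h : X → E) :
    ∫ y, h y ∂(ProbabilityTheory.cond μ I) = (μ I).toReal⁻¹ • ∫ y in I, h y ∂μ := by
  rw [ProbabilityTheory.cond, integral_smul_measure, ENNReal.toReal_inv]

theorem measure_mul_lintegral_cond {n : ℤ} {I : Set X} (hI : I ∈ D.atoms n) (h : X → ℝ≥0∞) :
    μ I * ∫⁻ y, h y ∂(ProbabilityTheory.cond μ I) = ∫⁻ y in I, h y ∂μ := by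
  rw [lintegral_cond_eq, ← mul_assoc, ENNReal.mul_inv_cancel (D.measure_atoms_pos n I hI).ne'
    (D.measure_atoms_lt_top n I hI).ne, one_mul]

theorem isProbabilityMeasure_cond {n : ℤ} {I : Set X} (hI : I ∈ D.atoms n) :
    IsProbabilityMeasure (ProbabilityTheory.cond μ I) :=
  ProbabilityTheory.cond_isProbabilityMeasure_of_finite (D.measure_atoms_pos n I hI).ne'
    (D.measure_atoms_lt_top n I hI).ne

theorem setLIntegral_lintegral_cond_cell {n m : ℤ} (hnm : n ≤ m) {I : Set X}
    (hI : I ∈ D.atoms n) (h : X → ℝ≥0∞) :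
    ∫⁻ y in I, ∫⁻ z, h z ∂(ProbabilityTheory.cond μ (D.cell m y)) ∂μ = ∫⁻ y in I, h y ∂μ := by
  have hIm := measurableSet_of_mem_atoms hI
  rw [setLIntegral_eq_tsum_atoms (D := D) m hIm, setLIntegral_eq_tsum_atoms (D := D) m hIm]
  refine tsum_congr fun J => ?_
  rcases subset_or_disjoint hnm hI J.2 with hJ | hJ
  · rw [inter_eq_right.2 hJ, setLIntegral_comp_cell J.2
      (fun K => ∫⁻ z, h z ∂(ProbabilityTheory.cond μ K)), mul_comm,
      measure_mul_lintegral_cond J.2]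
  · simp [hJ.inter_eq]

theorem lintegral_cond_lintegral_cond_cell {n m : ℤ} (hnm : n ≤ m) {I : Set X}
    (hI : I ∈ D.atoms n) (h : X → ℝ≥0∞) :
    ∫⁻ y, ∫⁻ z, h z ∂(ProbabilityTheory.cond μ (D.cell m y)) ∂(ProbabilityTheory.cond μ I) =
      ∫⁻ y, h y ∂(ProbabilityTheory.cond μ I) := by
  rw [lintegral_cond_eq, lintegral_cond_eq, setLIntegral_lintegral_cond_cell hnm hI]

theorem integrable_cond {n : ℤ} {I : Set X} (hI : I ∈ D.atoms n) {E : Type*}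
    [NormedAddCommGroup E] {h : X → E} (hh : IntegrableOn h I μ) :
    Integrable h (ProbabilityTheory.cond μ I) :=
  hh.smul_measure (ENNReal.inv_ne_top.2 (D.measure_atoms_pos n I hI).ne')

section RCLike

variable {𝕜 : Type*} [RCLike 𝕜]

theorem integrableOn_integral_cond_cell {n m : ℤ} (hnm : n ≤ m) {I : Set X}
    (hI : I ∈ D.atoms n) {h : X → 𝕜} (hh : IntegrableOn h I μ) :
    IntegrableOn (fun y => ∫ z, h z ∂(ProbabilityTheory.cond μ (D.cell m y))) I μ := by
  refine ⟨(measurable_comp_cell m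
    fun K => ∫ z, h z ∂(ProbabilityTheory.cond μ K)).aestronglyMeasurable, ?_⟩
  refine lt_of_le_of_lt (lintegral_mono fun y => enorm_integral_le_lintegral_enorm _) ?_
  rw [setLIntegral_lintegral_cond_cell hnm hI]
  exact hh.2

theorem integrable_cond_integral_cond_cell {n m : ℤ} (hnm : n ≤ m) {I : Set X}
    (hI : I ∈ D.atoms n) {h : X → 𝕜} (hh : IntegrableOn h I μ) :
    Integrable (fun y => ∫ z, h z ∂(ProbabilityTheory.cond μ (D.cell m y)))
      (ProbabilityTheory.cond μ I) :=
  integrable_cond hI (integrableOn_integral_cond_cell hnm hI hh)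

theorem integral_cond_integral_cond_cell {n m : ℤ} (hnm : n ≤ m) {I : Set X}
    (hI : I ∈ D.atoms n) {h : X → 𝕜} (hh : IntegrableOn h I μ) :
    ∫ y, ∫ z, h z ∂(ProbabilityTheory.cond μ (D.cell m y)) ∂(ProbabilityTheory.cond μ I) =
      ∫ y, h y ∂(ProbabilityTheory.cond μ I) := by
  have : Countable (D.atoms m) := (D.countable_atoms m).to_subtype
  have hIm := measurableSet_of_mem_atoms hI
  have key : ∀ k : X → 𝕜, IntegrableOn k I μ →
      ∫ y in I, k y ∂μ = ∑' J : D.atoms m, ∫ y in I ∩ (J : Set X), k y ∂μ := by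
    intro k hk
    conv_lhs => rw [← inter_iUnion_atoms (D := D) m I]
    refine integral_iUnion (fun J => hIm.inter (measurableSet_of_mem_atoms J.2))
      (pairwise_disjoint_inter_atoms m I) ?_
    rwa [inter_iUnion_atoms]
  rw [integral_cond_eq, integral_cond_eq, key _ hh,
    key _ (integrableOn_integral_cond_cell hnm hI hh)]
  congr 1
  refine tsum_congr fun J => ?_
  rcases subset_or_disjoint hnm hI J.2 with hJ | hJ
  · rw [inter_eq_right.2 hJ, setIntegral_congr_fun
      (g := fun _ => ∫ z, h z ∂(ProbabilityTheory.cond μ (J : Set X)))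
      (measurableSet_of_mem_atoms J.2) fun y hy => by simp only [cell_eq_of_mem J.2 hy],
      setIntegral_const, integral_cond_eq, smul_smul, Measure.real, mul_inv_cancel₀, one_smul]
    exact (ENNReal.toReal_pos (D.measure_atoms_pos m J J.2).ne'
      (D.measure_atoms_lt_top m J J.2).ne).ne'
  · simp [hJ.inter_eq]

theorem setAverage_eq_integral_cond (h : X → 𝕜) (I : Set X) :
    ⨍ y in I, h y ∂μ = ∫ y, h y ∂(ProbabilityTheory.cond μ I) := by
  rw [setAverage_eq, integral_cond_eq, Measure.real]

theorem martingaleDiff_eq {n : ℤ} {I : Set X} (hI : IsGreatest {k | I ∈ D.atoms k} n)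
    (h : X → 𝕜) {y : X} (hy : y ∈ I) :
    D.martingaleDiff I h y = ∫ z, h z ∂(ProbabilityTheory.cond μ (D.cell (n + 1) y)) -
      ∫ z, h z ∂(ProbabilityTheory.cond μ I) := by
  have hsub := cell_subset_of_mem (by omega : n ≤ n + 1) hI.1 hy
  have hmem : D.cell (n + 1) y ∈ D.children I := by
    rw [children_eq_of_isGreatest hI]
    exact ⟨D.cell_mem_atoms _ y, hsub⟩
  rw [martingaleDiff, tsum_eq_single ⟨_, hmem⟩]
  · simp [D.mem_cell, hy, setAverage_eq_integral_cond]
  · rintro ⟨J, hJ⟩ hne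
    rw [children_eq_of_isGreatest hI] at hJ
    refine indicator_of_notMem (fun hyJ => hne ?_) _
    exact Subtype.ext (cell_eq_of_mem hJ.1 hyJ).symm

theorem martingaleDiff_eq_zero {I : Set X} (hI : I ∈ D.allAtoms)
    (hn : ¬ ∃ n, IsGreatest {k | I ∈ D.atoms k} n) (h : X → 𝕜) : D.martingaleDiff I h = 0 := by
  funext y
  rw [martingaleDiff, children_eq_of_not_bddAbove hI hn,
    tsum_singleton I fun J => J.indicator (fun _ => ⨍ z in J, h z ∂μ) y]
  simp

end RCLike

end Cells

end AtomicFiltration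

/-! ### The Lorentz norm through the distribution function -/

section Rearrangement

open Filter Topology

variable {X : Type*} [MeasurableSpace X] {ν : Measure X} {u : X → ℝ≥0}

/-- The infimum defining `u^*(s)` is attained: along `t_k` decreasing to it the superlevel sets
increase, and the measure is continuous from below. -/
theorem measure_decreasingRearrangement_lt_le (s : ℝ) :
    ν {x | decreasingRearrangement ν u s < (u x : ℝ≥0∞)} ≤ ENNReal.ofReal s := by
  set S : Set ℝ≥0∞ := {t | ν {x | t < (u x : ℝ≥0∞)} ≤ ENNReal.ofReal s} with hS
  have hne : S.Nonempty := ⟨∞, by simp [hS]⟩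
  obtain ⟨t, ht, hlim, hmem⟩ := exists_seq_tendsto_sInf hne (OrderBot.bddBelow S)
  have heq : {x | decreasingRearrangement ν u s < (u x : ℝ≥0∞)} =
      ⋃ k, {x | t k < (u x : ℝ≥0∞)} := by
    ext x
    simp only [mem_ofPred_eq, mem_iUnion]
    constructor
    · exact fun h => (hlim.eventually_lt_const h).exists
    · rintro ⟨k, hk⟩
      exact (sInf_le (hmem k)).trans_lt hk
  rw [heq, Monotone.measure_iUnion]
  · exact iSup_le hmem
  · exact fun k l hkl x hx => (ht hkl).trans_lt hx

theorem lt_decreasingRearrangement_iff {s : ℝ} {t : ℝ≥0∞} :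
    t < decreasingRearrangement ν u s ↔ ENNReal.ofReal s < ν {x | t < (u x : ℝ≥0∞)} := by
  constructor
  · intro h
    by_contra! h'
    exact absurd (sInf_le h' : decreasingRearrangement ν u s ≤ t) h.not_ge
  · intro h
    by_contra! h'
    refine absurd (le_trans (measure_mono fun x hx => ?_)
      (measure_decreasingRearrangement_lt_le (ν := ν) (u := u) s)) h.not_ge
    exact h'.trans_lt hx

theorem volume_restrict_ofReal_lt (c : ℝ≥0∞) :
    volume.restrict (Ioi (0 : ℝ)) {t | ENNReal.ofReal t < c} = c := by
  rw [Measure.restrict_apply (measurableSet_lt ENNReal.measurable_ofReal measurable_const)]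
  induction c with
  | top => simp
  | coe c =>
    have : {t : ℝ | ENNReal.ofReal t < c} ∩ Ioi 0 = Ioo 0 (c : ℝ) := by
      ext t
      simp only [mem_inter_iff, mem_ofPred_eq, mem_Ioi, mem_Ioo]
      rw [and_comm]
      refine and_congr_right fun ht => ?_
      rw [ENNReal.ofReal_lt_iff_lt_toReal ht.le ENNReal.coe_ne_top, ENNReal.coe_toReal]
    rw [this, Real.volume_Ioo, sub_zero, ENNReal.ofReal_coe_nnreal]

theorem psiZero_nonneg {s : ℝ} (h0 : 0 ≤ s) (h1 : s ≤ 1) : 0 ≤ psiZero s := by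
  rw [psiZero_eq]
  exact add_nonneg h0 (Real.negMulLog_nonneg h0 h1)

theorem le_psiZero {s : ℝ} (h0 : 0 ≤ s) (h1 : s ≤ 1) : s ≤ psiZero s := by
  rw [psiZero_eq]
  exact le_add_of_nonneg_right (Real.negMulLog_nonneg h0 h1)

theorem psiZeroStieltjes_measure_Ioo {n : ℝ} (h0 : 0 ≤ n) (h1 : n ≤ 1) :
    psiZeroStieltjes.measure (Ioo 0 n) = ENNReal.ofReal (psiZero n) := by
  have hc : Continuous psiZeroStieltjes :=
    continuous_psiZero.comp (continuous_const.max (continuous_id.min continuous_const))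
  rw [StieltjesFunction.measure_Ioo, (hc.continuousAt (x := n)).continuousWithinAt.leftLim_eq]
  congr 1
  change psiZero (max 0 (min n 1)) - psiZero (max 0 (min 0 1)) = psiZero n
  rw [min_eq_left h1, max_eq_right h0, min_eq_left zero_le_one, max_self, psiZero_eq 0]
  simp

theorem psiZeroStieltjes_measure_restrict_lt {N : ℝ≥0∞} (hN : N ≤ 1) :
    psiZeroStieltjes.measure.restrict (Ioc 0 1) {s | ENNReal.ofReal s < N} =
      ENNReal.ofReal (psiZero N.toReal) := by
  have hN' : N ≠ ∞ := (hN.trans_lt ENNReal.one_lt_top).ne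
  have h1 : N.toReal ≤ 1 := ENNReal.toReal_le_of_le_ofReal zero_le_one (by simpa using hN)
  rw [Measure.restrict_apply (measurableSet_lt ENNReal.measurable_ofReal measurable_const),
    ← psiZeroStieltjes_measure_Ioo ENNReal.toReal_nonneg h1]
  congr 1
  ext s
  simp only [mem_inter_iff, mem_ofPred_eq, mem_Ioc, mem_Ioo]
  constructor
  · rintro ⟨h, hs, -⟩
    exact ⟨hs, (ENNReal.ofReal_lt_iff_lt_toReal hs.le hN').1 h⟩
  · rintro ⟨hs, h⟩
    exact ⟨(ENNReal.ofReal_lt_iff_lt_toReal hs.le hN').2 h, hs, h.le.trans h1⟩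

theorem antitone_measure_lt : Antitone fun t : ℝ => ν {x | ENNReal.ofReal t < (u x : ℝ≥0∞)} :=
  fun _ _ h => measure_mono fun _ hx => (ENNReal.ofReal_le_ofReal h).trans_lt hx

/-- Fubini on the region `t < u^*(s)`, which is also the region `s < N(t)`; the measure `dψ₀` has no
atoms and gives `(0, N)` the mass `ψ₀(N)`. In this form the norm is visibly concave in the
distribution function. -/
theorem lorentzNorm_eq_lintegral [IsProbabilityMeasure ν] :
    lorentzNorm ν u = ∫⁻ t in Ioi (0 : ℝ),
      ENNReal.ofReal (psiZero (ν {x | ENNReal.ofReal t < (u x : ℝ≥0∞)}).toReal) := by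
  set A : Set (ℝ × ℝ) :=
    {p | ENNReal.ofReal p.1 < ν {x | ENNReal.ofReal p.2 < (u x : ℝ≥0∞)}} with hA
  have hAm : MeasurableSet A := measurableSet_lt (ENNReal.measurable_ofReal.comp measurable_fst)
    ((antitone_measure_lt (ν := ν) (u := u)).measurable.comp measurable_snd)
  have h1 : ∀ s, decreasingRearrangement ν u s =
      ∫⁻ t in Ioi (0 : ℝ), A.indicator 1 (s, t) := by
    intro s
    rw [← volume_restrict_ofReal_lt (decreasingRearrangement ν u s)]
    simp_rw [lt_decreasingRearrangement_iff]
    rw [← lintegral_indicator_one (measurableSet_lt measurable_const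
      (antitone_measure_lt (ν := ν) (u := u)).measurable)]
    rfl
  have h2 : ∀ t, ∫⁻ s in Ioc 0 1, A.indicator 1 (s, t) ∂psiZeroStieltjes.measure =
      ENNReal.ofReal (psiZero (ν {x | ENNReal.ofReal t < (u x : ℝ≥0∞)}).toReal) := by
    intro t
    rw [← psiZeroStieltjes_measure_restrict_lt prob_le_one, ← lintegral_indicator_one
      (measurableSet_lt ENNReal.measurable_ofReal measurable_const)]
    rfl
  rw [lorentzNorm]
  simp_rw [h1]
  rw [lintegral_lintegral_swap (f := fun s t => A.indicator (1 : ℝ × ℝ → ℝ≥0∞) (s, t))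
    ((measurable_one.indicator hAm).aemeasurable)]
  simp_rw [h2]

theorem lintegral_eq_lintegral_measure_lt (hu : Measurable u) :
    ∫⁻ x, (u x : ℝ≥0∞) ∂ν =
      ∫⁻ t in Ioi (0 : ℝ), ν {x | ENNReal.ofReal t < (u x : ℝ≥0∞)} := by
  have h := lintegral_eq_lintegral_meas_lt ν (f := fun x => (u x : ℝ))
    (Eventually.of_forall fun x => (u x).2) hu.coe_nnreal_real.aemeasurable
  simp_rw [ENNReal.ofReal_coe_nnreal] at h
  rw [h]
  refine setLIntegral_congr_fun measurableSet_Ioi fun t ht => ?_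
  have ht' : (0 : ℝ) ≤ t := le_of_lt ht
  congr 1
  ext x
  simp only [mem_ofPred_eq]
  rw [ENNReal.ofReal_lt_iff_lt_toReal ht' ENNReal.coe_ne_top, ENNReal.coe_toReal]

theorem toReal_measure_le_one [IsProbabilityMeasure ν] (s : Set X) : (ν s).toReal ≤ 1 :=
  ENNReal.toReal_le_of_le_ofReal zero_le_one (by simpa using prob_le_one)

/-- Layer cake and `s ≤ ψ₀(s)`. It keeps the ratio `w/u` in `[1, ∞]`, the range where `α` is
monotone, whenever `u` is positive and finite. -/
theorem lintegral_le_lorentzNorm [IsProbabilityMeasure ν] (hu : Measurable u) :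
    ∫⁻ x, (u x : ℝ≥0∞) ∂ν ≤ lorentzNorm ν u := by
  rw [lorentzNorm_eq_lintegral, lintegral_eq_lintegral_measure_lt hu]
  refine lintegral_mono fun t => ?_
  conv_lhs => rw [← ENNReal.ofReal_toReal (measure_ne_top ν _)]
  exact ENNReal.ofReal_le_ofReal (le_psiZero ENNReal.toReal_nonneg (toReal_measure_le_one _))

end Rearrangement

/-! ### Quantitative concavity of `ψ₀` -/

section Entropy

/-- `n − m log n` is the value at `m` of the tangent to `ψ₀` at `n`, and it exceeds `ψ₀(m)` by at
least `(√m − √n)²`. This gap absorbs `c|m − n| = c|√m − √n|(√m + √n)` by AM–GM, together with `(√m +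
√n)² ≤ 2(m + n)`. -/
theorem psiZero_add_mul_abs_sub_le {m n c : ℝ} (hm : 0 ≤ m) (hn : 0 < n) :
    psiZero m + c * |m - n| ≤ n - m * Real.log n + c ^ 2 * (m + n) / 2 := by
  rcases hm.eq_or_lt with rfl | hm
  · rw [psiZero_eq, zero_sub, abs_neg, abs_of_pos hn]
    simp only [Real.negMulLog_zero, zero_add, zero_mul, sub_zero]
    nlinarith [mul_nonneg hn.le (sq_nonneg (c - 1))]
  · obtain ⟨a, ha, rfl⟩ : ∃ a, 0 < a ∧ m = a ^ 2 :=
      ⟨√m, Real.sqrt_pos.2 hm, (Real.sq_sqrt hm.le).symm⟩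
    obtain ⟨b, hb, rfl⟩ : ∃ b, 0 < b ∧ n = b ^ 2 :=
      ⟨√n, Real.sqrt_pos.2 hn, (Real.sq_sqrt hn.le).symm⟩
    have h1 : Real.log b - Real.log a ≤ b / a - 1 := by
      rw [← Real.log_div hb.ne' ha.ne']
      exact Real.log_le_sub_one_of_pos (div_pos hb ha)
    have h2 : a ^ 2 * (Real.log b - Real.log a) ≤ a * b - a ^ 2 := by
      calc a ^ 2 * (Real.log b - Real.log a) ≤ a ^ 2 * (b / a - 1) := by gcongr
        _ = a * b - a ^ 2 := by field_simp
    have h3 : |a ^ 2 - b ^ 2| = |a - b| * (a + b) := by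
      rw [sq_sub_sq, abs_mul, abs_of_pos (add_pos ha hb), mul_comm]
    rw [psiZero_eq, Real.negMulLog, Real.log_pow, Real.log_pow, h3]
    push_cast
    nlinarith [sq_nonneg (|a - b| - c * (a + b) / 2), sq_abs (a - b),
      mul_nonneg (sq_nonneg c) (sq_nonneg (a - b))]

/-- The pointwise bound averaged over `m = M y`. The gain is kept linear, with a free `c`, so that
it can next be integrated over the levels `t`; optimizing in `c` here would leave squares under that
integral. -/
theorem lintegral_psiZero_add_le {Ω : Type*} [MeasurableSpace Ω] {P : Measure Ω}
    [IsProbabilityMeasure P] {M : Ω → ℝ≥0∞} (hM : Measurable M) (hM1 : ∀ y, M y ≤ 1) {n : ℝ≥0∞}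
    (hn : ∫⁻ y, M y ∂P = n) (c : ℝ≥0) :
    ∫⁻ y, ENNReal.ofReal (psiZero (M y).toReal) ∂P +
        c * ∫⁻ y, ENNReal.ofReal |(M y).toReal - n.toReal| ∂P ≤
      ENNReal.ofReal (psiZero n.toReal) + c ^ 2 * n := by
  -- At `n = 0` the tangent to `ψ₀` is vertical, but then `M` vanishes almost everywhere.
  rcases eq_or_ne n 0 with rfl | hn0
  · have h0 : M =ᵐ[P] 0 := (lintegral_eq_zero_iff hM).1 hn
    have e1 : ∫⁻ y, ENNReal.ofReal (psiZero (M y).toReal) ∂P = 0 := by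
      rw [lintegral_congr_ae (g := fun _ => 0), lintegral_zero]
      filter_upwards [h0] with y hy
      simp [hy, psiZero_eq]
    have e2 : ∫⁻ y, ENNReal.ofReal |(M y).toReal - (0 : ℝ≥0∞).toReal| ∂P = 0 := by
      rw [lintegral_congr_ae (g := fun _ => 0), lintegral_zero]
      filter_upwards [h0] with y hy
      simp [hy]
    rw [e1, e2]
    simp
  have hn1 : n ≤ 1 := by
    rw [← hn]
    calc ∫⁻ y, M y ∂P ≤ ∫⁻ _, 1 ∂P := lintegral_mono hM1
      _ = 1 := by simp
  have hnt : n ≠ ∞ := (hn1.trans_lt ENNReal.one_lt_top).ne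
  have hr0 : 0 < n.toReal := ENNReal.toReal_pos hn0 hnt
  have hr1 : n.toReal ≤ 1 := ENNReal.toReal_le_of_le_ofReal zero_le_one (by simpa using hn1)
  have hlog : 0 ≤ -Real.log n.toReal := neg_nonneg.2 (Real.log_nonpos hr0.le hr1)
  have hmeas : Measurable fun y => ENNReal.ofReal (psiZero (M y).toReal) :=
    (continuous_psiZero.measurable.comp hM.ennreal_toReal).ennreal_ofReal
  rw [← lintegral_const_mul' _ _ ENNReal.coe_ne_top, ← lintegral_add_left hmeas]
  have hpt : ∀ y, ENNReal.ofReal (psiZero (M y).toReal) +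
      c * ENNReal.ofReal |(M y).toReal - n.toReal| ≤
      (n + (c : ℝ≥0∞) ^ 2 / 2 * n) +
        (ENNReal.ofReal (-Real.log n.toReal) + (c : ℝ≥0∞) ^ 2 / 2) * M y := by
    intro y
    have hMt : M y ≠ ∞ := ((hM1 y).trans_lt ENNReal.one_lt_top).ne
    obtain ⟨m, hm⟩ : ∃ m : ℝ≥0, (m : ℝ≥0∞) = M y := ⟨_, ENNReal.coe_toNNReal hMt⟩
    obtain ⟨n', hn'⟩ : ∃ n' : ℝ≥0, (n' : ℝ≥0∞) = n := ⟨_, ENNReal.coe_toNNReal hnt⟩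
    have hm1 : (m : ℝ) ≤ 1 := by
      have := hM1 y
      rw [← hm] at this
      exact_mod_cast this
    have key := psiZero_add_mul_abs_sub_le (m := m) (n := n') (c := c) m.2
      (by rw [← hn'] at hr0; exact hr0)
    have hlog' : 0 ≤ -Real.log n' := by
      rw [← hn'] at hlog
      exact hlog
    rw [← hm, ← hn']
    simp only [ENNReal.coe_toReal]
    have e2 : (2 : ℝ≥0∞) = ENNReal.ofReal 2 := by simp
    rw [← ENNReal.ofReal_coe_nnreal (p := c), ← ENNReal.ofReal_coe_nnreal (p := m),
      ← ENNReal.ofReal_coe_nnreal (p := n'), ← ENNReal.ofReal_mul c.coe_nonneg,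
      ← ENNReal.ofReal_add (psiZero_nonneg m.coe_nonneg hm1) (by positivity),
      ← ENNReal.ofReal_pow c.coe_nonneg, e2, ← ENNReal.ofReal_div_of_pos two_pos,
      ← ENNReal.ofReal_mul (by positivity), ← ENNReal.ofReal_add (by positivity) (by positivity),
      ← ENNReal.ofReal_add hlog' (by positivity),
      ← ENNReal.ofReal_mul (add_nonneg hlog' (by positivity)),
      ← ENNReal.ofReal_add (by positivity)
        (mul_nonneg (add_nonneg hlog' (by positivity)) m.coe_nonneg)]
    exact ENNReal.ofReal_le_ofReal (key.trans_eq (by ring))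
  refine (lintegral_mono hpt).trans_eq ?_
  rw [lintegral_add_left measurable_const, lintegral_const, measure_univ, mul_one,
    lintegral_const_mul _ hM, hn, psiZero_eq, ENNReal.ofReal_add hr0.le
      (Real.negMulLog_nonneg hr0.le hr1), ENNReal.ofReal_toReal hnt, Real.negMulLog, neg_mul,
      ← mul_neg, ENNReal.ofReal_mul hr0.le, ENNReal.ofReal_toReal hnt]
  have h2 : (c : ℝ≥0∞) ^ 2 = (c : ℝ≥0∞) ^ 2 / 2 + (c : ℝ≥0∞) ^ 2 / 2 := (ENNReal.add_halves _).symm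
  conv_rhs => rw [h2]
  ring

end Entropy

/-! ### Drop of the Lorentz norm from an atom to the cells inside it -/

namespace AtomicFiltration

variable {X : Type*} [MeasurableSpace X] {μ : Measure X} {D : AtomicFiltration μ}

open ProbabilityTheory in
/-- Concavity of the Lorentz norm along a generation, with a quantitative gain. -/
theorem lintegral_lorentzNorm_cell_add_le {n m : ℤ} (hnm : n ≤ m) {I : Set X}
    (hI : I ∈ D.atoms n) {u : X → ℝ≥0} (hu : Measurable u)
    (hu_int : ∫⁻ x in I, (u x : ℝ≥0∞) ∂μ < ∞) (c : ℝ≥0) :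
    ∫⁻ y, lorentzNorm (cond μ (D.cell m y)) u ∂(cond μ I) +
        c * ∫⁻ y, ENNReal.ofReal |(∫⁻ x, (u x : ℝ≥0∞) ∂(cond μ (D.cell m y))).toReal -
          (∫⁻ x, (u x : ℝ≥0∞) ∂(cond μ I)).toReal| ∂(cond μ I) ≤
      lorentzNorm (cond μ I) u + c ^ 2 * ∫⁻ x, (u x : ℝ≥0∞) ∂(cond μ I) := by
  have hPI := isProbabilityMeasure_cond hI
  have hPJ : ∀ y, IsProbabilityMeasure (cond μ (D.cell m y)) := fun y =>
    isProbabilityMeasure_cond (D.cell_mem_atoms m y)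
  set N : Set X → ℝ → ℝ≥0∞ := fun J t => cond μ J {x | ENNReal.ofReal t < (u x : ℝ≥0∞)} with hN
  have hNm : ∀ J, Measurable (N J) := fun J => antitone_measure_lt.measurable
  have hfin : ∀ {k : ℤ} {J : Set X}, J ∈ D.atoms k → J ⊆ I →
      ∫⁻ x, (u x : ℝ≥0∞) ∂(cond μ J) ≠ ∞ := by
    intro k J hJ hJI
    rw [lintegral_cond_eq]
    exact ENNReal.mul_ne_top (ENNReal.inv_ne_top.2 (D.measure_atoms_pos k J hJ).ne')
      ((lintegral_mono_set hJI).trans_lt hu_int).ne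
  -- The distribution function of `I` is the average of those of its cells.
  have hmean : ∀ t, ∫⁻ y, N (D.cell m y) t ∂(cond μ I) = N I t := by
    intro t
    have hs : MeasurableSet {x | ENNReal.ofReal t < (u x : ℝ≥0∞)} :=
      measurableSet_lt measurable_const hu.coe_nnreal_ennreal
    have := lintegral_cond_lintegral_cond_cell hnm hI
      (({x | ENNReal.ofReal t < (u x : ℝ≥0∞)}).indicator 1)
    simpa [lintegral_indicator_one hs] using this
  have hpt : ∀ t, ∫⁻ y, ENNReal.ofReal (psiZero (N (D.cell m y) t).toReal) ∂(cond μ I) +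
      c * ∫⁻ y, ENNReal.ofReal |(N (D.cell m y) t).toReal - (N I t).toReal| ∂(cond μ I) ≤
      ENNReal.ofReal (psiZero (N I t).toReal) + c ^ 2 * N I t := fun t =>
    lintegral_psiZero_add_le (measurable_comp_cell m fun J => N J t) (fun y => prob_le_one)
      (hmean t) c
  have hmψ : Measurable fun p : X × ℝ =>
      ENNReal.ofReal (psiZero (N (D.cell m p.1) p.2).toReal) :=
    measurable_uncurry_cell (F := fun J t => ENNReal.ofReal (psiZero (N J t).toReal)) m
      fun J _ => (continuous_psiZero.measurable.comp (hNm J).ennreal_toReal).ennreal_ofReal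
  have hmd : Measurable fun p : X × ℝ =>
      ENNReal.ofReal |(N (D.cell m p.1) p.2).toReal - (N I p.2).toReal| :=
    measurable_uncurry_cell (F := fun J t => ENNReal.ofReal |(N J t).toReal - (N I t).toReal|) m
      fun J _ => ((hNm J).ennreal_toReal.sub (hNm I).ennreal_toReal).abs.ennreal_ofReal
  -- By layer cake, two means differ by at most the `L¹(dt)` distance of the distribution functions.
  -- Two one-sided bounds replace the subtraction of extended integrals.
  have hd : ∀ᵐ y ∂(cond μ I), ENNReal.ofReal |(∫⁻ x, (u x : ℝ≥0∞) ∂(cond μ (D.cell m y))).toReal -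
      (∫⁻ x, (u x : ℝ≥0∞) ∂(cond μ I)).toReal| ≤ ∫⁻ t in Ioi (0 : ℝ),
        ENNReal.ofReal |(N (D.cell m y) t).toReal - (N I t).toReal| := by
    filter_upwards [ae_cond_mem (measurableSet_of_mem_atoms hI)] with y hy
    have hfy := hfin (D.cell_mem_atoms m y) (cell_subset_of_mem hnm hI hy)
    have hfI := hfin hI subset_rfl
    set d := ∫⁻ t in Ioi (0 : ℝ), ENNReal.ofReal |(N (D.cell m y) t).toReal - (N I t).toReal|
      with hddef
    rcases eq_or_ne d ∞ with hdt | hdt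
    · rw [hdt]; exact le_top
    have tri : ∀ a b : ℝ≥0∞, a ≠ ∞ → b ≠ ∞ → a ≤ b + ENNReal.ofReal |a.toReal - b.toReal| := by
      intro a b ha hb
      rw [← ENNReal.ofReal_toReal ha, ← ENNReal.ofReal_toReal hb,
        ← ENNReal.ofReal_add ENNReal.toReal_nonneg (abs_nonneg _)]
      refine ENNReal.ofReal_le_ofReal ?_
      rw [ENNReal.ofReal_toReal ha, ENNReal.ofReal_toReal hb]
      linarith [le_abs_self (a.toReal - b.toReal)]
    have h1 : ∫⁻ x, (u x : ℝ≥0∞) ∂(cond μ (D.cell m y)) ≤ ∫⁻ x, (u x : ℝ≥0∞) ∂(cond μ I) + d := by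
      rw [lintegral_eq_lintegral_measure_lt hu, lintegral_eq_lintegral_measure_lt hu, hddef,
        ← lintegral_add_left (hNm I)]
      exact lintegral_mono fun t => tri _ _ (measure_ne_top _ _) (measure_ne_top _ _)
    have h2 : ∫⁻ x, (u x : ℝ≥0∞) ∂(cond μ I) ≤ ∫⁻ x, (u x : ℝ≥0∞) ∂(cond μ (D.cell m y)) + d := by
      rw [lintegral_eq_lintegral_measure_lt hu, lintegral_eq_lintegral_measure_lt hu, hddef,
        ← lintegral_add_left (hNm (D.cell m y))]
      refine lintegral_mono fun t => ?_
      rw [abs_sub_comm]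
      exact tri _ _ (measure_ne_top _ _) (measure_ne_top _ _)
    refine ENNReal.ofReal_le_of_le_toReal ?_
    rw [abs_sub_le_iff, sub_le_iff_le_add, sub_le_iff_le_add, add_comm d.toReal,
      add_comm d.toReal, ← ENNReal.toReal_add hfI hdt, ← ENNReal.toReal_add hfy hdt]
    exact ⟨ENNReal.toReal_mono (ENNReal.add_ne_top.2 ⟨hfI, hdt⟩) h1,
      ENNReal.toReal_mono (ENNReal.add_ne_top.2 ⟨hfy, hdt⟩) h2⟩
  calc _ ≤ ∫⁻ y, (∫⁻ t in Ioi (0 : ℝ), ENNReal.ofReal (psiZero (N (D.cell m y) t).toReal))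
          ∂(cond μ I) + c * ∫⁻ y, (∫⁻ t in Ioi (0 : ℝ),
            ENNReal.ofReal |(N (D.cell m y) t).toReal - (N I t).toReal|) ∂(cond μ I) := by
        refine add_le_add (lintegral_mono fun y => lorentzNorm_eq_lintegral.le) ?_
        gcongr 1
        exact lintegral_mono_ae hd
    _ = ∫⁻ t in Ioi (0 : ℝ), (∫⁻ y, ENNReal.ofReal (psiZero (N (D.cell m y) t).toReal) ∂(cond μ I) +
          c * ∫⁻ y, ENNReal.ofReal |(N (D.cell m y) t).toReal - (N I t).toReal| ∂(cond μ I)) := by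
        rw [lintegral_lintegral_swap (f := fun y t =>
            ENNReal.ofReal (psiZero (N (D.cell m y) t).toReal)) hmψ.aemeasurable,
          lintegral_lintegral_swap (f := fun y t =>
            ENNReal.ofReal |(N (D.cell m y) t).toReal - (N I t).toReal|) hmd.aemeasurable,
          lintegral_add_left hmψ.lintegral_prod_left', lintegral_const_mul' _ _ ENNReal.coe_ne_top]
    _ ≤ ∫⁻ t in Ioi (0 : ℝ), (ENNReal.ofReal (psiZero (N I t).toReal) + c ^ 2 * N I t) :=
        lintegral_mono hpt
    _ = _ := by
        rw [lintegral_add_right _ ((hNm I).const_mul _), lintegral_const_mul _ (hNm I),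
          ← lorentzNorm_eq_lintegral, lintegral_eq_lintegral_measure_lt hu]

end AtomicFiltration

/-! ### The profile `g` and the denominator `v = u g(w/u)` -/

section Profile

/-- The function `r ↦ C_α + ∫₁^r dt / (t α(t))`, with values in `[C_α, 2 C_α]`. -/
noncomputable def bumpProfile (α : ℝ → ℝ≥0) (r : ℝ≥0∞) : ℝ :=
  (bumpConst α).toReal +
    (∫⁻ t in {t : ℝ | 1 < t ∧ ENNReal.ofReal t ≤ r}, (ENNReal.ofReal t * (α t : ℝ≥0∞))⁻¹).toReal

variable {α : ℝ → ℝ≥0}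

theorem bumpConst_pos : 0 < bumpConst α :=
  lt_of_lt_of_le (ENNReal.inv_pos.2 ENNReal.coe_ne_top) le_self_add

theorem toReal_bumpConst_pos (hC : bumpConst α < ∞) : 0 < (bumpConst α).toReal :=
  ENNReal.toReal_pos bumpConst_pos.ne' hC.ne

/-- This is the role of the summand `1/α(1)` in `C_α`: with `α` increasing it yields `1/(rα(r)) ≤ C`
for `r ≥ 1`. -/
theorem one_le_toReal_bumpConst_mul (hC : bumpConst α < ∞) : 1 ≤ (bumpConst α).toReal * α 1 := by
  have h1 : ((α 1 : ℝ≥0∞)⁻¹) ≤ bumpConst α := le_self_add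
  have h0 : (α 1 : ℝ≥0∞) ≠ 0 := fun h => by
    rw [h, ENNReal.inv_zero] at h1
    exact absurd hC (not_lt.2 h1)
  have h2 : 1 ≤ bumpConst α * (α 1 : ℝ≥0∞) := by
    calc (1 : ℝ≥0∞) = (α 1 : ℝ≥0∞)⁻¹ * (α 1 : ℝ≥0∞) :=
          (ENNReal.inv_mul_cancel h0 ENNReal.coe_ne_top).symm
      _ ≤ _ := by gcongr
  have h3 := ENNReal.toReal_mono (ENNReal.mul_ne_top hC.ne ENNReal.coe_ne_top) h2
  simpa using h3

theorem le_bumpProfile (r : ℝ≥0∞) : (bumpConst α).toReal ≤ bumpProfile α r :=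
  le_add_of_nonneg_right ENNReal.toReal_nonneg

theorem setLIntegral_le_bumpConst {s : Set ℝ} (hs : s ⊆ Ioi 1) :
    ∫⁻ t in s, (ENNReal.ofReal t * (α t : ℝ≥0∞))⁻¹ ≤ bumpConst α :=
  (lintegral_mono_set hs).trans le_add_self

theorem bumpProfile_le (hC : bumpConst α < ∞) (r : ℝ≥0∞) :
    bumpProfile α r ≤ 2 * (bumpConst α).toReal := by
  rw [bumpProfile, two_mul]
  exact add_le_add_right (ENNReal.toReal_mono hC.ne
    (setLIntegral_le_bumpConst fun t ht => ht.1)) _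

theorem monotone_bumpProfile (hC : bumpConst α < ∞) : Monotone (bumpProfile α) := by
  intro r s hrs
  refine add_le_add_right (ENNReal.toReal_mono
    ((setLIntegral_le_bumpConst fun t ht => ht.1).trans_lt hC).ne ?_) _
  exact lintegral_mono_set fun t ht => ⟨ht.1, ht.2.trans hrs⟩

theorem bumpProfile_ofReal {r : ℝ} (hr : 1 ≤ r) : bumpProfile α (ENNReal.ofReal r) =
    (bumpConst α).toReal + (∫⁻ t in Ioc 1 r, (ENNReal.ofReal t * (α t : ℝ≥0∞))⁻¹).toReal := by
  rw [bumpProfile]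
  congr 4
  ext t
  exact and_congr_right fun _ => ENNReal.ofReal_le_ofReal_iff (zero_le_one.trans hr)

theorem bumpProfile_eq_add (hC : bumpConst α < ∞) {a b : ℝ} (ha : 1 ≤ a) (hab : a ≤ b) :
    bumpProfile α (ENNReal.ofReal b) = bumpProfile α (ENNReal.ofReal a) +
      (∫⁻ t in Ioc a b, (ENNReal.ofReal t * (α t : ℝ≥0∞))⁻¹).toReal := by
  rw [bumpProfile_ofReal ha, bumpProfile_ofReal (ha.trans hab), add_assoc]
  congr 1
  rw [← ENNReal.toReal_add,
    ← lintegral_union measurableSet_Ioc (Ioc_disjoint_Ioc_of_le le_rfl),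
    Ioc_union_Ioc_eq_Ioc ha hab]
  · exact ((setLIntegral_le_bumpConst fun t ht => ht.1).trans_lt hC).ne
  · exact ((setLIntegral_le_bumpConst fun t ht => ha.trans_lt ht.1).trans_lt hC).ne

theorem alpha_pos (hα : MonotoneOn α (Ici 1)) (hC : bumpConst α < ∞) {r : ℝ} (hr : 1 ≤ r) :
    0 < (α r : ℝ) := by
  have h1 := one_le_toReal_bumpConst_mul hC
  have h2 : (0 : ℝ) < α 1 := by
    by_contra! h
    rw [le_antisymm h (α 1).coe_nonneg] at h1
    norm_num at h1
  exact h2.trans_le (hα self_mem_Ici hr hr)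

/-- Concavity of `g`: the integrand `1/(tα(t))` decreases, so on either side of `r` it compares with
its value at `r`, which is a supergradient even where `α` jumps. -/
theorem bumpProfile_le_add (hα : MonotoneOn α (Ici 1)) (hC : bumpConst α < ∞) {r s : ℝ}
    (hr : 1 ≤ r) (hs : 1 ≤ s) :
    bumpProfile α (ENNReal.ofReal s) ≤
      bumpProfile α (ENNReal.ofReal r) + (s - r) / (r * α r) := by
  have hr0 : 0 < r := zero_lt_one.trans_le hr
  have hpos : 0 < r * α r := mul_pos hr0 (alpha_pos hα hC hr)
  have hinv : (ENNReal.ofReal r * (α r : ℝ≥0∞))⁻¹ = ENNReal.ofReal (r * α r)⁻¹ := by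
    rw [← ENNReal.ofReal_coe_nnreal, ← ENNReal.ofReal_mul hr0.le, ENNReal.ofReal_inv_of_pos hpos]
  have hconst : ∀ a b : ℝ, ∫⁻ _ in Ioc a b, (ENNReal.ofReal r * (α r : ℝ≥0∞))⁻¹ =
      ENNReal.ofReal ((r * α r)⁻¹ * (b - a)) := by
    intro a b
    rw [setLIntegral_const, Real.volume_Ioc, hinv, ENNReal.ofReal_mul (inv_pos.2 hpos).le]
  rcases le_total r s with h | h
  · rw [bumpProfile_eq_add hC hr h]
    refine add_le_add_right (ENNReal.toReal_le_of_le_ofReal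
      (div_nonneg (sub_nonneg.2 h) hpos.le) ?_) _
    rw [div_eq_inv_mul, ← hconst]
    refine setLIntegral_mono' measurableSet_Ioc fun t ht => ?_
    gcongr
    · exact ht.1.le
    · exact hα hr (hr.trans ht.1.le) ht.1.le
  · rw [bumpProfile_eq_add hC hs h]
    have h2 : (r - s) / (r * α r) ≤
        (∫⁻ t in Ioc s r, (ENNReal.ofReal t * (α t : ℝ≥0∞))⁻¹).toReal := by
      refine (ENNReal.ofReal_le_iff_le_toReal ?_).1 ?_
      · exact ((setLIntegral_le_bumpConst fun t ht => hs.trans_lt ht.1).trans_lt hC).ne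
      rw [div_eq_inv_mul, ← hconst]
      refine setLIntegral_mono' measurableSet_Ioc fun t ht => ?_
      gcongr
      · exact ht.2
      · exact hα (hs.trans ht.1.le) hr ht.2
    have h3 : (s - r) / (r * α r) = -((r - s) / (r * α r)) := by ring
    linarith

/-- The concave, positively homogeneous function `(u, w) ↦ u g(w / u)`, where
`g = bumpProfile α`. -/
noncomputable def bumpDenom (α : ℝ → ℝ≥0) (u w : ℝ≥0∞) : ℝ :=
  u.toReal * bumpProfile α (w / u)

theorem le_bumpDenom (u w : ℝ≥0∞) : (bumpConst α).toReal * u.toReal ≤ bumpDenom α u w := by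
  rw [bumpDenom, mul_comm]
  exact mul_le_mul_of_nonneg_left (le_bumpProfile _) ENNReal.toReal_nonneg

theorem bumpDenom_nonneg (u w : ℝ≥0∞) : 0 ≤ bumpDenom α u w :=
  (mul_nonneg ENNReal.toReal_nonneg ENNReal.toReal_nonneg).trans (le_bumpDenom u w)

theorem bumpDenom_le (hC : bumpConst α < ∞) (u w : ℝ≥0∞) :
    bumpDenom α u w ≤ 2 * (bumpConst α).toReal * u.toReal := by
  rw [bumpDenom, mul_comm]
  exact mul_le_mul_of_nonneg_right (bumpProfile_le hC _) ENNReal.toReal_nonneg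

theorem bumpDenom_le_top (hC : bumpConst α < ∞) (u w : ℝ≥0∞) :
    bumpDenom α u w ≤ u.toReal * bumpProfile α ∞ :=
  mul_le_mul_of_nonneg_left (monotone_bumpProfile hC le_top) ENNReal.toReal_nonneg

theorem div_eq_ofReal_toReal_div {u w : ℝ≥0∞} (hu : 0 < u.toReal) (hu' : u ≠ ∞) (hw : w ≠ ∞) :
    w / u = ENNReal.ofReal (w.toReal / u.toReal) := by
  rw [ENNReal.ofReal_div_of_pos hu, ENNReal.ofReal_toReal hu', ENNReal.ofReal_toReal hw]

/-- The supporting line of `g` at `r`, multiplied by `u`: a supporting plane at `(u₀, w₀)` of the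
concave function `u g(w/u)`. -/
theorem bumpDenom_le_add (hα : MonotoneOn α (Ici 1)) (hC : bumpConst α < ∞)
    {u w u₀ w₀ : ℝ≥0∞} (huw : u ≤ w) (hw : w ≠ ∞) (huw₀ : u₀ ≤ w₀) (hw₀ : w₀ ≠ ∞)
    (hu₀ : 0 < u₀.toReal) {r : ℝ} (hr : r = w₀.toReal / u₀.toReal) :
    bumpDenom α u w ≤ u.toReal * bumpProfile α (w₀ / u₀) +
      (w.toReal - r * u.toReal) / (r * α r) := by
  have hu : u ≠ ∞ := ne_top_of_le_ne_top hw huw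
  have hu₀' : u₀ ≠ ∞ := ne_top_of_le_ne_top hw₀ huw₀
  have hr1 : 1 ≤ r := by
    rw [hr, one_le_div hu₀]
    exact ENNReal.toReal_mono hw₀ huw₀
  have hpos : 0 < r * α r := mul_pos (zero_lt_one.trans_le hr1) (alpha_pos hα hC hr1)
  -- For `u = 0` the left side is `0` whatever `w / 0` is, and the right side reduces to `w/(rα(r))
  -- ≥ 0`.
  rcases (ENNReal.toReal_nonneg (a := u)).eq_or_lt with h | h
  · rw [bumpDenom, ← h]
    simp only [zero_mul, mul_zero, sub_zero, zero_add]
    exact div_nonneg ENNReal.toReal_nonneg hpos.le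
  · have hs1 : 1 ≤ w.toReal / u.toReal := by
      rw [one_le_div h]
      exact ENNReal.toReal_mono hw huw
    have key := bumpProfile_le_add hα hC hr1 hs1
    rw [bumpDenom, div_eq_ofReal_toReal_div h hu hw, div_eq_ofReal_toReal_div hu₀ hu₀' hw₀, ← hr]
    calc _ ≤ u.toReal * _ := mul_le_mul_of_nonneg_left key h.le
      _ = _ := by field_simp

end Profile

/-! ### Convexity of `|x|²/v` with remainder, and the balance of constants -/

section Jensen

variable {Ω : Type*} [MeasurableSpace Ω] {P : Measure Ω} {𝕜 : Type*} [RCLike 𝕜]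

/-- For `v > 0`, `|x|²/v` equals its tangent `2 Re(l̄x) − |l|²v` plus `|x − vl|²/v`, and a square
satisfies `s²/v ≥ 2ks − k²v`. This linear form integrates without a further Cauchy–Schwarz. -/
theorem two_mul_le_norm_sq_div (x l : 𝕜) {v : ℝ} (hv : 0 ≤ v) (hxv : v = 0 → x = 0) (k : ℝ) :
    2 * (RCLike.re l * RCLike.re x + RCLike.im l * RCLike.im x) - ‖l‖ ^ 2 * v +
      2 * k * ‖x - v • l‖ - k ^ 2 * v ≤ ‖x‖ ^ 2 / v := by
  rcases hv.eq_or_lt with rfl | hv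
  · simp [hxv rfl]
  · rw [le_div_iff₀ hv]
    have h1 : ‖x - v • l‖ ^ 2 = ‖x‖ ^ 2 -
        2 * v * (RCLike.re l * RCLike.re x + RCLike.im l * RCLike.im x) + ‖l‖ ^ 2 * v ^ 2 := by
      simp only [RCLike.norm_sq_eq_def, map_sub, RCLike.smul_re, RCLike.smul_im]
      ring
    nlinarith [sq_nonneg (‖x - v • l‖ - k * v)]

/-- Joint convexity of `(x, v) ↦ ‖x‖² / v`, with remainder terms. -/
theorem norm_integral_sq_div_add_le {x : Ω → 𝕜} {v : Ω → ℝ} (hx : Integrable x P)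
    (hv : Integrable v P) (hv0 : ∀ y, 0 ≤ v y) (hxv : ∀ᵐ y ∂P, v y = 0 → x y = 0)
    (hQ : Integrable (fun y => ‖x y‖ ^ 2 / v y) P) {v₀ : ℝ} (hv₀ : 0 < v₀) (k : ℝ) :
    ‖∫ y, x y ∂P‖ ^ 2 / v₀ + ‖∫ y, x y ∂P‖ ^ 2 / v₀ ^ 2 * (v₀ - ∫ y, v y ∂P) +
      2 * k * ∫ y, ‖x y - v y • (v₀⁻¹ • ∫ z, x z ∂P)‖ ∂P - k ^ 2 * ∫ y, v y ∂P ≤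
      ∫ y, ‖x y‖ ^ 2 / v y ∂P := by
  -- The tangent is taken at `(∫ x, v₀)`, where `v₀` need not be the mean of `v`; the discrepancy is
  -- the term with `v₀ − ∫ v`.
  set l : 𝕜 := v₀⁻¹ • ∫ z, x z ∂P with hl
  have hre : Integrable (fun y => RCLike.re (x y)) P := hx.re
  have him : Integrable (fun y => RCLike.im (x y)) P := hx.im
  have hd : Integrable (fun y => ‖x y - v y • l‖) P := (hx.sub (hv.smul_const l)).norm
  have i1 : Integrable (fun y => RCLike.re l * RCLike.re (x y) + RCLike.im l * RCLike.im (x y)) P :=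
    (hre.const_mul _).add (him.const_mul _)
  have i2 : Integrable (fun y => 2 * (RCLike.re l * RCLike.re (x y) +
      RCLike.im l * RCLike.im (x y)) - ‖l‖ ^ 2 * v y) P := (i1.const_mul _).sub (hv.const_mul _)
  have i3 : Integrable (fun y => 2 * (RCLike.re l * RCLike.re (x y) +
      RCLike.im l * RCLike.im (x y)) - ‖l‖ ^ 2 * v y + 2 * k * ‖x y - v y • l‖) P :=
    i2.add (hd.const_mul _)
  have key := integral_mono_ae (i3.sub (hv.const_mul (k ^ 2))) hQ (by
    filter_upwards [hxv] with y hy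
    exact two_mul_le_norm_sq_div (x y) l (hv0 y) hy k)
  simp only [Pi.sub_apply] at key
  rw [integral_sub i3 (hv.const_mul _), integral_add i2 (hd.const_mul _),
    integral_sub (i1.const_mul _) (hv.const_mul _), integral_const_mul, integral_const_mul,
    integral_const_mul, integral_const_mul,
    integral_add (hre.const_mul _) (him.const_mul _), integral_const_mul, integral_const_mul,
    integral_re hx, integral_im hx] at key
  refine le_trans (le_of_eq ?_) key
  congr 2
  have hnl : ‖l‖ ^ 2 = ‖∫ y, x y ∂P‖ ^ 2 / v₀ ^ 2 := by
    rw [hl, norm_smul, mul_pow, norm_inv, inv_pow, Real.norm_eq_abs, sq_abs]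
    ring
  rw [hnl, hl, RCLike.smul_re, RCLike.smul_im, RCLike.norm_sq_eq_def]
  field_simp
  ring

/-- The bound on `Dl` and `(p + q)² ≤ 2p² + 2q²` split `Dl²/(a w₀)` in two. The `E`-part is at most
`2C E²/u₀`, since `1/(ar) ≤ C`. In the `Dv`-part, `v₀ ≤ 2Cu₀` gives `2X²/u₀² ≤ 8C²X²/v₀²`, and the
two drops give `Dv²/(u₀ra) ≤ 4(v₀ − vm)`. Hence the weights `2C` and `32C² = 8C² · 4`. -/
theorem bellman_arithmetic {C u₀ v₀ vm w₀ wm r a X E Dv Dl Q₁ Q₂ : ℝ} (hC : 0 < C) (hu₀ : 0 < u₀)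
    (hr : 1 ≤ r) (ha : 1 ≤ C * a) (hw₀ : w₀ = r * u₀) (hv₀ : 0 < v₀) (hv₀' : v₀ ≤ 2 * C * u₀)
    (hDl0 : 0 ≤ Dl)
    (h₁ : X ^ 2 / u₀ + E ^ 2 / u₀ ≤ Q₁) (h₂ : X ^ 2 / v₀ + X ^ 2 / v₀ ^ 2 * (v₀ - vm) ≤ Q₂)
    (hvm : (w₀ - wm) / (r * a) ≤ v₀ - vm) (hwm : Dv ^ 2 / (4 * u₀) ≤ w₀ - wm)
    (hDl : Dl ≤ E + X / u₀ * Dv) :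
    2 * C * (X ^ 2 / u₀) + 32 * C ^ 2 * (X ^ 2 / v₀) + Dl ^ 2 / (a * w₀) ≤
      2 * C * Q₁ + 32 * C ^ 2 * Q₂ := by
  have ha0 : 0 < a := by
    by_contra! h
    nlinarith
  have hr0 : 0 < r := by linarith
  have e1 : Dl ^ 2 ≤ 2 * E ^ 2 + 2 * (X / u₀ * Dv) ^ 2 := by
    nlinarith [sq_nonneg (E - X / u₀ * Dv)]
  have e2 : Dl ^ 2 / (a * w₀) ≤ 2 * (E ^ 2 / u₀) * (1 / (a * r)) +
      2 * X ^ 2 / u₀ ^ 2 * (Dv ^ 2 / (u₀ * r * a)) := by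
    rw [hw₀]
    calc Dl ^ 2 / (a * (r * u₀)) ≤ (2 * E ^ 2 + 2 * (X / u₀ * Dv) ^ 2) / (a * (r * u₀)) := by
          gcongr
      _ = _ := by field_simp
  have e3 : 1 / (a * r) ≤ C := by
    rw [div_le_iff₀ (by positivity)]
    nlinarith
  have e4 : 2 * (E ^ 2 / u₀) * (1 / (a * r)) ≤ 2 * (E ^ 2 / u₀) * C :=
    mul_le_mul_of_nonneg_left e3 (by positivity)
  have e5 : 2 * X ^ 2 / u₀ ^ 2 ≤ 8 * C ^ 2 * (X ^ 2 / v₀ ^ 2) := by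
    have hq : v₀ ^ 2 ≤ 4 * C ^ 2 * u₀ ^ 2 := by nlinarith
    rw [div_le_iff₀ (by positivity)]
    calc 2 * X ^ 2 = 2 * (X ^ 2 / v₀ ^ 2) * v₀ ^ 2 := by field_simp
      _ ≤ 2 * (X ^ 2 / v₀ ^ 2) * (4 * C ^ 2 * u₀ ^ 2) := by gcongr
      _ = _ := by ring
  have e6 : Dv ^ 2 / (u₀ * r * a) ≤ 4 * (v₀ - vm) := by
    have : Dv ^ 2 / (4 * u₀) / (r * a) ≤ (w₀ - wm) / (r * a) := by gcongr
    calc Dv ^ 2 / (u₀ * r * a) = 4 * (Dv ^ 2 / (4 * u₀) / (r * a)) := by field_simp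
      _ ≤ _ := by linarith
  have e7 : 2 * X ^ 2 / u₀ ^ 2 * (Dv ^ 2 / (u₀ * r * a)) ≤
      8 * C ^ 2 * (X ^ 2 / v₀ ^ 2) * (4 * (v₀ - vm)) :=
    mul_le_mul e5 e6 (by positivity) (by positivity)
  have e8 := mul_le_mul_of_nonneg_left h₁ (by positivity : 0 ≤ 2 * C)
  have e9 := mul_le_mul_of_nonneg_left h₂ (by positivity : 0 ≤ 32 * C ^ 2)
  linarith

end Jensen

/-! ### The Bellman function and its main inequality -/

section Bellman

variable {𝕜 : Type*} [RCLike 𝕜]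

/-- The Bellman function of the problem, at an average `x`, a mean `u` and a Lorentz norm `w`. -/
noncomputable def bellman (α : ℝ → ℝ≥0) (x : 𝕜) (u w : ℝ≥0∞) : ℝ :=
  2 * (bumpConst α).toReal * (‖x‖ ^ 2 / u.toReal) +
    32 * (bumpConst α).toReal ^ 2 * (‖x‖ ^ 2 / bumpDenom α u w)

theorem norm_sq_div_bumpDenom_le {α : ℝ → ℝ≥0} (hC : bumpConst α < ∞) (x : 𝕜) (u w : ℝ≥0∞) :
    (bumpConst α).toReal * (‖x‖ ^ 2 / bumpDenom α u w) ≤ ‖x‖ ^ 2 / u.toReal := by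
  have hC0 := toReal_bumpConst_pos hC
  rcases (ENNReal.toReal_nonneg (a := u)).eq_or_lt with h | h
  · simp [bumpDenom, ← h]
  · have hd : 0 < bumpDenom α u w := (mul_pos hC0 h).trans_le (le_bumpDenom u w)
    calc (bumpConst α).toReal * (‖x‖ ^ 2 / bumpDenom α u w)
        ≤ (bumpConst α).toReal * (‖x‖ ^ 2 / ((bumpConst α).toReal * u.toReal)) := by
          gcongr
          exact le_bumpDenom u w
      _ = _ := by field_simp

theorem bellman_nonneg (α : ℝ → ℝ≥0) (x : 𝕜) (u w : ℝ≥0∞) : 0 ≤ bellman α x u w := by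
  have := bumpDenom_nonneg (α := α) u w
  rw [bellman]
  positivity

/-- `v ≥ Cu` turns the second summand into at most `32C|x|²/u`, so the total is `34C ≤ 36C`. -/
theorem bellman_le {α : ℝ → ℝ≥0} (hC : bumpConst α < ∞) (x : 𝕜) (u w : ℝ≥0∞) :
    bellman α x u w ≤ 36 * (bumpConst α).toReal * (‖x‖ ^ 2 / u.toReal) := by
  have hC0 := toReal_bumpConst_pos hC
  have h := mul_le_mul_of_nonneg_left (norm_sq_div_bumpDenom_le hC x u w)
    (by positivity : 0 ≤ 32 * (bumpConst α).toReal)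
  have h2 : 0 ≤ (bumpConst α).toReal * (‖x‖ ^ 2 / u.toReal) := by positivity
  rw [bellman]
  nlinarith

theorem measurable_bumpDenom {α : ℝ → ℝ≥0} (hC : bumpConst α < ∞) {Ω : Type*}
    [MeasurableSpace Ω] {U W : Ω → ℝ≥0∞} (hU : Measurable U) (hW : Measurable W) :
    Measurable fun y => bumpDenom α (U y) (W y) :=
  hU.ennreal_toReal.mul ((monotone_bumpProfile hC).measurable.comp (hW.div hU))

variable {Ω : Type*} [MeasurableSpace Ω] {P : Measure Ω} [IsProbabilityMeasure P]

/-- The main inequality for the Bellman function, in its dynamical form. -/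
theorem ofReal_bellman_add_le {α : ℝ → ℝ≥0} (hα : MonotoneOn α (Ici 1)) (hC : bumpConst α < ∞)
    {x : Ω → 𝕜} {U W : Ω → ℝ≥0∞} (hx : Integrable x P) (hU : Measurable U) (hW : Measurable W)
    (hUW : ∀ y, U y ≤ W y) (hxU : ∀ᵐ y ∂P, U y = 0 → x y = 0)
    (hQ : Integrable (fun y => ‖x y‖ ^ 2 / (U y).toReal) P) {u₀ w₀ : ℝ≥0∞}
    (hu : ∫⁻ y, U y ∂P = u₀) (hu0 : u₀ ≠ 0) (hut : u₀ ≠ ∞) (huw : u₀ ≤ w₀)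
    (hgap : ∀ c : ℝ≥0, ∫⁻ y, W y ∂P + c * ∫⁻ y, ENNReal.ofReal |(U y).toReal - u₀.toReal| ∂P ≤
      w₀ + c ^ 2 * u₀) :
    ENNReal.ofReal (bellman α (∫ y, x y ∂P) u₀ w₀) + (∫⁻ y, ‖x y - ∫ z, x z ∂P‖ₑ ∂P) ^ 2 /
        (open Classical in if w₀ = ∞ then ∞ else (α (w₀ / u₀).toReal : ℝ≥0∞) * w₀) ≤
      ∫⁻ y, ENNReal.ofReal (bellman α (x y) (U y) (W y)) ∂P := by
  set C := (bumpConst α).toReal with hCdef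
  have hC0 : 0 < C := toReal_bumpConst_pos hC
  have hu₀ : 0 < u₀.toReal := ENNReal.toReal_pos hu0 hut
  have hUfin : ∀ᵐ y ∂P, U y < ∞ := ae_lt_top hU (hu ▸ hut)
  have hUi : Integrable (fun y => (U y).toReal) P :=
    integrable_toReal_of_lintegral_ne_top hU.aemeasurable (hu ▸ hut)
  have hUm : ∫ y, (U y).toReal ∂P = u₀.toReal := by
    rw [integral_toReal hU.aemeasurable hUfin, hu]
  have hxU' : ∀ᵐ y ∂P, (U y).toReal = 0 → x y = 0 := by
    filter_upwards [hxU, hUfin] with y h1 h2 h3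
    exact h1 ((ENNReal.toReal_eq_zero_iff _).1 h3 |>.resolve_right h2.ne)
  set V : Ω → ℝ := fun y => bumpDenom α (U y) (W y) with hV
  have hVm : Measurable V := measurable_bumpDenom hC hU hW
  have hV0 : ∀ y, 0 ≤ V y := fun y => bumpDenom_nonneg _ _
  have hVi : Integrable V P := (hUi.const_mul (2 * C)).mono' hVm.aestronglyMeasurable
    (Filter.Eventually.of_forall fun y => by
      rw [Real.norm_of_nonneg (hV0 y)]
      exact bumpDenom_le hC _ _)
  have hxV : ∀ᵐ y ∂P, V y = 0 → x y = 0 := by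
    filter_upwards [hxU'] with y h1 h2
    refine h1 (le_antisymm (not_lt.1 fun h3 => ?_) ENNReal.toReal_nonneg)
    have := le_bumpDenom (α := α) (U y) (W y)
    rw [show bumpDenom α (U y) (W y) = 0 from h2] at this
    exact absurd this (not_le.2 (mul_pos hC0 h3))
  have hQV : Integrable (fun y => ‖x y‖ ^ 2 / V y) P := by
    refine (hQ.const_mul C⁻¹).mono'
      ((hx.1.norm.pow 2).aemeasurable.div hVm.aemeasurable).aestronglyMeasurable
      (Filter.Eventually.of_forall fun y => ?_)
    rw [Real.norm_of_nonneg (div_nonneg (sq_nonneg _) (hV0 y)), ← div_eq_inv_mul,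
      le_div_iff₀ hC0, mul_comm]
    exact norm_sq_div_bumpDenom_le hC _ _ _
  have hB : ∫⁻ y, ENNReal.ofReal (bellman α (x y) (U y) (W y)) ∂P =
      ENNReal.ofReal (2 * C * ∫ y, ‖x y‖ ^ 2 / (U y).toReal ∂P +
        32 * C ^ 2 * ∫ y, ‖x y‖ ^ 2 / V y ∂P) := by
    rw [← integral_const_mul, ← integral_const_mul,
      ← integral_add (hQ.const_mul _) (hQV.const_mul _)]
    exact (ofReal_integral_eq_lintegral_ofReal ((hQ.const_mul _).add (hQV.const_mul _))
      (Filter.Eventually.of_forall fun y => bellman_nonneg α (x y) (U y) (W y))).symm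
  set X := ‖∫ y, x y ∂P‖ with hX
  set v₀ := bumpDenom α u₀ w₀ with hv₀def
  have hv₀ : 0 < v₀ := (mul_pos hC0 hu₀).trans_le (le_bumpDenom _ _)
  set E := ∫ y, ‖x y - (U y).toReal • (u₀.toReal⁻¹ • ∫ z, x z ∂P)‖ ∂P with hE
  have h₁ : X ^ 2 / u₀.toReal + E ^ 2 / u₀.toReal ≤ ∫ y, ‖x y‖ ^ 2 / (U y).toReal ∂P := by
    -- `k = E/u₀` maximizes `2kE − k²u₀`, with maximum `E²/u₀`.
    have := norm_integral_sq_div_add_le hx hUi (fun _ => ENNReal.toReal_nonneg) hxU' hQ hu₀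
      (E / u₀.toReal)
    rw [hUm, sub_self, mul_zero, add_zero, ← hE, ← hX] at this
    refine le_trans (le_of_eq ?_) this
    field_simp
    ring
  have h₂ : X ^ 2 / v₀ + X ^ 2 / v₀ ^ 2 * (v₀ - ∫ y, V y ∂P) ≤ ∫ y, ‖x y‖ ^ 2 / V y ∂P := by
    -- With `k = 0` only the gain from the drop of `v` is kept.
    have := norm_integral_sq_div_add_le hx hVi hV0 hxV hQV hv₀ 0
    simpa using this
  rw [hB]
  -- For `w₀ = ∞` the added term is `0`. It suffices that the mean of `V` is at most `v₀`, which
  -- holds because `g(∞)` is the largest value of `g`.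
  rcases eq_or_ne w₀ ∞ with hw | hw
  · rw [if_pos hw, ENNReal.div_top, add_zero]
    refine ENNReal.ofReal_le_ofReal ?_
    have hVle : ∫ y, V y ∂P ≤ v₀ := by
      rw [hv₀def, bumpDenom, hw, ENNReal.top_div_of_ne_top hut, ← hUm, ← integral_mul_const]
      exact integral_mono hVi (hUi.mul_const _) fun y => bumpDenom_le_top hC _ _
    have h3 : 0 ≤ X ^ 2 / v₀ ^ 2 * (v₀ - ∫ y, V y ∂P) :=
      mul_nonneg (by positivity) (sub_nonneg.2 hVle)
    have h4 : 0 ≤ E ^ 2 / u₀.toReal := by positivity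
    rw [bellman, ← hX, ← hCdef, ← hv₀def]
    gcongr <;> linarith
  · rw [if_neg hw]
    have hWle : ∫⁻ y, W y ∂P ≤ w₀ := by simpa using hgap 0
    have hWt : ∫⁻ y, W y ∂P ≠ ∞ := ne_top_of_le_ne_top hw hWle
    have hWfin : ∀ᵐ y ∂P, W y < ∞ := ae_lt_top hW hWt
    have hWi : Integrable (fun y => (W y).toReal) P :=
      integrable_toReal_of_lintegral_ne_top hW.aemeasurable hWt
    have hdi : Integrable (fun y => |(U y).toReal - u₀.toReal|) P :=
      (hUi.sub (integrable_const _)).abs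
    set Dv := ∫ y, |(U y).toReal - u₀.toReal| ∂P with hDv
    have hDv0 : 0 ≤ Dv := integral_nonneg fun y => abs_nonneg _
    set wm := ∫ y, (W y).toReal ∂P with hwm
    have hwm' : (∫⁻ y, W y ∂P) = ENNReal.ofReal wm := by
      rw [hwm, integral_toReal hW.aemeasurable hWfin, ENNReal.ofReal_toReal hWt]
    have hgap' : Dv ^ 2 / (4 * u₀.toReal) ≤ w₀.toReal - wm := by
      -- The maximizer of `c Dv − c² u₀`, whose maximum is `Dv²/(4u₀)`.
      obtain ⟨c, hcd⟩ : ∃ c, c = Dv / (2 * u₀.toReal) := ⟨_, rfl⟩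
      have hc : 0 ≤ c := by
        rw [hcd]
        positivity
      have h := hgap c.toNNReal
      have hcoe : (c.toNNReal : ℝ≥0∞) =
          ENNReal.ofReal c := rfl
      have hwm0 : 0 ≤ wm := integral_nonneg fun y => ENNReal.toReal_nonneg
      rw [hwm', ← ofReal_integral_eq_lintegral_ofReal hdi
        (Filter.Eventually.of_forall fun y => abs_nonneg _), ← hDv, hcoe,
        ← ENNReal.ofReal_mul hc, ← ENNReal.ofReal_add hwm0 (by positivity),
        ← ENNReal.ofReal_toReal hw, ← ENNReal.ofReal_toReal hut, ← ENNReal.ofReal_pow hc,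
        ← ENNReal.ofReal_mul (by positivity),
        ← ENNReal.ofReal_add ENNReal.toReal_nonneg (by positivity),
        ENNReal.ofReal_le_ofReal_iff (by positivity)] at h
      have e1 : c * Dv = 2 * (Dv ^ 2 / (4 * u₀.toReal)) := by
        rw [hcd]
        field_simp
        ring
      have e2 : c ^ 2 * u₀.toReal = Dv ^ 2 / (4 * u₀.toReal) := by
        rw [hcd]
        field_simp
        ring
      rw [e1, e2] at h
      linarith
    set r := w₀.toReal / u₀.toReal with hr
    have hr1 : 1 ≤ r := by
      rw [hr, one_le_div hu₀]
      exact ENNReal.toReal_mono hw huw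
    -- The supporting plane of `u g(w/u)` at `(u₀, w₀)` is averaged; its part in `u` is exact
    -- because `U` has mean `u₀`.
    have hvm : (w₀.toReal - wm) / (r * α r) ≤ v₀ - ∫ y, V y ∂P := by
      have iU := hUi.mul_const (bumpProfile α (w₀ / u₀))
      have iW : Integrable (fun y => ((W y).toReal - r * (U y).toReal) / (r * α r)) P :=
        (hWi.sub (hUi.const_mul r)).div_const _
      have h := integral_mono_ae hVi (iU.add iW) (by
        filter_upwards [hWfin] with y hy
        exact bumpDenom_le_add hα hC (hUW y) hy.ne huw hw hu₀ hr)
      simp only [Pi.add_apply] at h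
      rw [integral_add iU iW, integral_mul_const, integral_div, integral_sub hWi
        (hUi.const_mul r), integral_const_mul, hUm, ← hwm] at h
      have e : r * u₀.toReal = w₀.toReal := by
        rw [hr]
        field_simp
      rw [e] at h
      have e2 : v₀ = u₀.toReal * bumpProfile α (w₀ / u₀) := rfl
      rw [← e2] at h
      have e3 : (w₀.toReal - wm) / (r * α r) = -((wm - w₀.toReal) / (r * α r)) := by ring
      linarith
    have hxd : Integrable (fun y => x y - ∫ z, x z ∂P) P := hx.sub (integrable_const _)
    set Dl := ∫ y, ‖x y - ∫ z, x z ∂P‖ ∂P with hDl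
    have hDl0 : 0 ≤ Dl := integral_nonneg fun y => norm_nonneg _
    -- The fluctuation of `x` is split into its deviation from the multiple `U x₀/u₀` of the weight,
    -- with `x₀ = ∫ x`, and the fluctuation of that multiple.
    have hDle : Dl ≤ E + X / u₀.toReal * Dv := by
      have iE : Integrable (fun y => ‖x y - (U y).toReal • (u₀.toReal⁻¹ • ∫ z, x z ∂P)‖) P :=
        (hx.sub (hUi.smul_const _)).norm
      rw [hDl, hE, hDv, ← integral_const_mul, ← integral_add iE (hdi.const_mul _)]
      refine integral_mono hxd.norm (iE.add (hdi.const_mul _)) fun y => ?_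
      have e : x y - ∫ z, x z ∂P = (x y - (U y).toReal • (u₀.toReal⁻¹ • ∫ z, x z ∂P)) +
          ((U y).toReal - u₀.toReal) • (u₀.toReal⁻¹ • ∫ z, x z ∂P) := by
        rw [sub_smul, smul_inv_smul₀ hu₀.ne']
        abel
      have e' : X / u₀.toReal * |(U y).toReal - u₀.toReal| =
          ‖((U y).toReal - u₀.toReal) • (u₀.toReal⁻¹ • ∫ z, x z ∂P)‖ := by
        rw [norm_smul, norm_smul, norm_inv, Real.norm_eq_abs, Real.norm_of_nonneg hu₀.le, ← hX]
        ring
      simp only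
      rw [e']
      conv_lhs => rw [e]
      exact norm_add_le _ _
    have hα0 := alpha_pos hα hC hr1
    have hw₀ : 0 < w₀.toReal := hu₀.trans_le (ENNReal.toReal_mono hw huw)
    have hterm : (∫⁻ y, ‖x y - ∫ z, x z ∂P‖ₑ ∂P) ^ 2 / ((α (w₀ / u₀).toReal : ℝ≥0∞) * w₀) =
        ENNReal.ofReal (Dl ^ 2 / (α r * w₀.toReal)) := by
      rw [← ofReal_integral_norm_eq_lintegral_enorm hxd, ← hDl, ENNReal.toReal_div, ← hr,
        ENNReal.ofReal_div_of_pos (by positivity), ENNReal.ofReal_pow hDl0,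
        ENNReal.ofReal_mul (α r).coe_nonneg, ENNReal.ofReal_coe_nnreal, ENNReal.ofReal_toReal hw]
    rw [hterm, ← ENNReal.ofReal_add (bellman_nonneg α _ _ _) (by positivity)]
    refine ENNReal.ofReal_le_ofReal ?_
    have ha : 1 ≤ C * α r := (one_le_toReal_bumpConst_mul hC).trans
      (mul_le_mul_of_nonneg_left (hα self_mem_Ici hr1 hr1) hC0.le)
    exact bellman_arithmetic hC0 hu₀ hr1 ha (by rw [hr]; field_simp) hv₀ (bumpDenom_le hC _ _)
      hDl0 h₁ h₂ hvm hgap' hDle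

end Bellman

/-- Telescoping without subtraction: a finite set of indices sits in an interval starting at some
`a`, and `S a ≥ 0` is dropped. -/
theorem ENNReal.tsum_int_le_of_add_le {S T : ℤ → ℝ≥0∞} {M : ℝ≥0∞}
    (hST : ∀ n, S n + T n ≤ S (n + 1)) (hS : ∀ n, S n ≤ M) : ∑' n, T n ≤ M := by
  have key : ∀ (a : ℤ) (k : ℕ), S a + ∑ i ∈ Finset.range k, T (a + i) ≤ S (a + k) := by
    intro a k
    induction k with
    | zero => simp
    | succ k ih =>
      rw [Finset.sum_range_succ, ← add_assoc]
      calc _ ≤ S (a + k) + T (a + k) := by gcongr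
        _ ≤ S (a + k + 1) := hST _
        _ = _ := by push_cast; rw [add_assoc]
  rw [ENNReal.tsum_eq_iSup_sum]
  refine iSup_le fun s => ?_
  obtain ⟨a, ha⟩ := s.bddBelow
  obtain ⟨b, hb⟩ := s.bddAbove
  have hsub : s ⊆ (Finset.range (b - a + 1).toNat).image fun i : ℕ => a + i := by
    intro n hn
    have h1 : a ≤ n := ha hn
    have h2 : n ≤ b := hb hn
    exact Finset.mem_image.2 ⟨(n - a).toNat, by simp only [Finset.mem_range]; omega, by omega⟩
  calc ∑ n ∈ s, T n ≤ ∑ n ∈ (Finset.range (b - a + 1).toNat).image fun i : ℕ => a + i, T n :=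
        Finset.sum_le_sum_of_subset hsub
    _ = ∑ i ∈ Finset.range (b - a + 1).toNat, T (a + i) :=
        Finset.sum_image fun i _ j _ h => by simpa using h
    _ ≤ S (a + (b - a + 1).toNat) := le_add_self.trans (key a _)
    _ ≤ M := hS _

/-! ### Cauchy–Schwarz and integration against the density `u` -/

section CauchySchwarz

variable {X : Type*} [MeasurableSpace X] {𝕜 : Type*} [RCLike 𝕜]

theorem lintegral_enorm_sq_le {ν : Measure X} {f : X → 𝕜} (hf : AEStronglyMeasurable f ν) :
    (∫⁻ x, ‖f x‖ₑ ∂ν) ^ 2 ≤ (∫⁻ x, ‖f x‖ₑ ^ 2 ∂ν) * ν univ := by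
  have h := ENNReal.lintegral_mul_le_Lp_mul_Lq ν Real.HolderConjugate.two_two hf.enorm
    (aemeasurable_const (b := 1))
  simp only [Pi.mul_apply, mul_one, lintegral_const, ENNReal.rpow_two, one_pow, one_mul] at h
  calc (∫⁻ x, ‖f x‖ₑ ∂ν) ^ 2
      ≤ ((∫⁻ x, ‖f x‖ₑ ^ 2 ∂ν) ^ (1 / (2 : ℝ)) * ν univ ^ (1 / (2 : ℝ))) ^ 2 := by gcongr
    _ = _ := by
        rw [mul_pow, ← ENNReal.rpow_natCast, ← ENNReal.rpow_natCast, ← ENNReal.rpow_mul,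
          ← ENNReal.rpow_mul]
        norm_num

theorem lintegral_enorm_coe_mul {P : Measure X} {u : X → ℝ≥0} (hu : Measurable u) (f : X → 𝕜) :
    ∫⁻ x, ‖((u x : ℝ) : 𝕜) * f x‖ₑ ∂P = ∫⁻ x, ‖f x‖ₑ ∂(P.withDensity fun x => (u x : ℝ≥0∞)) := by
  rw [lintegral_withDensity_eq_lintegral_mul_non_measurable _ hu.coe_nnreal_ennreal
    (Filter.Eventually.of_forall fun x => ENNReal.coe_lt_top)]
  refine lintegral_congr fun x => ?_
  rw [enorm_mul, Pi.mul_apply]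
  congr 1
  rw [← ofReal_norm, RCLike.norm_ofReal, NNReal.abs_eq, ENNReal.ofReal_coe_nnreal]

theorem integrable_coe_mul_iff {P : Measure X} {u : X → ℝ≥0} (hu : Measurable u) {f : X → 𝕜} :
    Integrable (fun x => ((u x : ℝ) : 𝕜) * f x) P ↔
      Integrable f (P.withDensity fun x => (u x : ℝ≥0∞)) := by
  rw [integrable_withDensity_iff_integrable_smul hu]
  simp_rw [NNReal.smul_def, RCLike.real_smul_eq_coe_mul]

end CauchySchwarz

/-! ### The Bellman function along the filtration -/

namespace AtomicFiltration

open ProbabilityTheory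

variable {X : Type*} [MeasurableSpace X] {μ : Measure X} {D : AtomicFiltration μ}
  {𝕜 : Type*} [RCLike 𝕜]

theorem cond_withDensity (I : Set X) (hI : MeasurableSet I) (u : X → ℝ≥0) :
    (cond μ I).withDensity (fun x => (u x : ℝ≥0∞)) =
      (μ I)⁻¹ • (μ.withDensity fun x => (u x : ℝ≥0∞)).restrict I := by
  rw [ProbabilityTheory.cond, withDensity_smul_measure, restrict_withDensity hI]

section Weight

variable {u : X → ℝ≥0} {f : X → 𝕜}

theorem mul_lintegral_withDensity_cond {n : ℤ} {I : Set X} (hI : I ∈ D.atoms n) (h : X → ℝ≥0∞) :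
    μ I * ∫⁻ x, h x ∂((cond μ I).withDensity fun x => (u x : ℝ≥0∞)) =
      ∫⁻ x in I, h x ∂(μ.withDensity fun x => (u x : ℝ≥0∞)) := by
  rw [cond_withDensity I (measurableSet_of_mem_atoms hI), lintegral_smul_measure, smul_eq_mul,
    ← mul_assoc, ENNReal.mul_inv_cancel (D.measure_atoms_pos n I hI).ne'
    (D.measure_atoms_lt_top n I hI).ne, one_mul]

theorem lintegral_enorm_cond_sq_le (hu : Measurable u) {n : ℤ} {I : Set X} (hI : I ∈ D.atoms n)
    (hf : AEStronglyMeasurable f (μ.withDensity fun x => (u x : ℝ≥0∞))) :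
    (∫⁻ x, ‖((u x : ℝ) : 𝕜) * f x‖ₑ ∂(cond μ I)) ^ 2 ≤
      (∫⁻ x, ‖f x‖ₑ ^ 2 ∂((cond μ I).withDensity fun x => (u x : ℝ≥0∞))) *
        ∫⁻ x, (u x : ℝ≥0∞) ∂(cond μ I) := by
  have hIm := measurableSet_of_mem_atoms hI
  have hf' : AEStronglyMeasurable f ((cond μ I).withDensity fun x => (u x : ℝ≥0∞)) := by
    rw [cond_withDensity I hIm]
    exact hf.restrict.smul_measure _
  rw [lintegral_enorm_coe_mul hu]
  refine (lintegral_enorm_sq_le hf').trans_eq ?_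
  rw [withDensity_apply _ .univ, setLIntegral_univ]

theorem enorm_integral_cond_sq_le (hu : Measurable u) {n : ℤ} {I : Set X} (hI : I ∈ D.atoms n)
    (hf : AEStronglyMeasurable f (μ.withDensity fun x => (u x : ℝ≥0∞))) :
    ‖∫ x, ((u x : ℝ) : 𝕜) * f x ∂(cond μ I)‖ₑ ^ 2 ≤
      (∫⁻ x, ‖f x‖ₑ ^ 2 ∂((cond μ I).withDensity fun x => (u x : ℝ≥0∞))) *
        ∫⁻ x, (u x : ℝ≥0∞) ∂(cond μ I) := by
  refine le_trans ?_ (lintegral_enorm_cond_sq_le hu hI hf)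
  gcongr
  exact enorm_integral_le_lintegral_enorm _

theorem integral_cond_eq_zero (hu : Measurable u) {n : ℤ} {I : Set X} (hI : I ∈ D.atoms n)
    (hf : AEStronglyMeasurable f (μ.withDensity fun x => (u x : ℝ≥0∞)))
    (h0 : ∫⁻ x, (u x : ℝ≥0∞) ∂(cond μ I) = 0) :
    ∫ x, ((u x : ℝ) : 𝕜) * f x ∂(cond μ I) = 0 := by
  have := enorm_integral_cond_sq_le hu hI hf
  rw [h0, mul_zero] at this
  simpa using this

theorem lintegral_cond_ne_top {n : ℤ} {I : Set X} (hI : I ∈ D.atoms n)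
    (hu_int : ∫⁻ x in I, (u x : ℝ≥0∞) ∂μ < ∞) : ∫⁻ x, (u x : ℝ≥0∞) ∂(cond μ I) ≠ ∞ := by
  rw [lintegral_cond_eq]
  exact ENNReal.mul_ne_top (ENNReal.inv_ne_top.2 (D.measure_atoms_pos n I hI).ne') hu_int.ne

/-- The Cauchy–Schwarz inequality `|I| |⟨f u⟩_I|² / ⟨u⟩_I ≤ ∫_I |f|² u`. -/
theorem ofReal_norm_sq_div_mul_measure_le (hu : Measurable u) {n : ℤ} {I : Set X}
    (hI : I ∈ D.atoms n) (hf : AEStronglyMeasurable f (μ.withDensity fun x => (u x : ℝ≥0∞))) :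
    ENNReal.ofReal (‖∫ x, ((u x : ℝ) : 𝕜) * f x ∂(cond μ I)‖ ^ 2 /
        (∫⁻ x, (u x : ℝ≥0∞) ∂(cond μ I)).toReal) * μ I ≤
      ∫⁻ x in I, ‖f x‖ₑ ^ 2 ∂(μ.withDensity fun x => (u x : ℝ≥0∞)) := by
  rw [← mul_lintegral_withDensity_cond hI, mul_comm]
  gcongr
  have h := enorm_integral_cond_sq_le hu hI hf
  set U := ∫⁻ x, (u x : ℝ≥0∞) ∂(cond μ I)
  rcases (ENNReal.toReal_nonneg (a := U)).eq_or_lt with h0 | h0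
  · simp [← h0]
  · obtain ⟨hU0, hUt⟩ := ENNReal.toReal_pos_iff.1 h0
    rw [ENNReal.ofReal_div_of_pos h0, ENNReal.ofReal_toReal hUt.ne, ENNReal.ofReal_pow
      (norm_nonneg _), ofReal_norm]
    exact ENNReal.div_le_of_le_mul h

theorem lintegral_norm_sq_div_cell_le (hu : Measurable u) (n : ℤ)
    (hf : AEStronglyMeasurable f (μ.withDensity fun x => (u x : ℝ≥0∞))) :
    ∫⁻ y, ENNReal.ofReal (‖∫ x, ((u x : ℝ) : 𝕜) * f x ∂(cond μ (D.cell n y))‖ ^ 2 /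
        (∫⁻ x, (u x : ℝ≥0∞) ∂(cond μ (D.cell n y))).toReal) ∂μ ≤
      ∫⁻ x, ‖f x‖ₑ ^ 2 ∂(μ.withDensity fun x => (u x : ℝ≥0∞)) := by
  have : Countable (D.atoms n) := (D.countable_atoms n).to_subtype
  rw [lintegral_comp_cell (D := D) n fun J => ENNReal.ofReal
    (‖∫ x, ((u x : ℝ) : 𝕜) * f x ∂(cond μ J)‖ ^ 2 / (∫⁻ x, (u x : ℝ≥0∞) ∂(cond μ J)).toReal)]
  refine (ENNReal.tsum_le_tsum fun J => ofReal_norm_sq_div_mul_measure_le hu J.2 hf).trans ?_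
  rw [← lintegral_iUnion (fun J : D.atoms n => measurableSet_of_mem_atoms J.2)
    fun J K h => D.disjoint_atoms n J.2 K.2 fun e => h (Subtype.ext e)]
  exact setLIntegral_le_lintegral _ _

theorem integrableOn_coe_mul (hu : Measurable u) {n : ℤ} {I : Set X} (hI : I ∈ D.atoms n)
    (hu_int : ∫⁻ x in I, (u x : ℝ≥0∞) ∂μ < ∞)
    (hf : MemLp f 2 (μ.withDensity fun x => (u x : ℝ≥0∞))) :
    IntegrableOn (fun x => ((u x : ℝ) : 𝕜) * f x) I μ := by
  have hIm := measurableSet_of_mem_atoms hI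
  rw [IntegrableOn, integrable_coe_mul_iff hu, ← restrict_withDensity hIm]
  have : IsFiniteMeasure ((μ.withDensity fun x => (u x : ℝ≥0∞)).restrict I) :=
    ⟨by rwa [Measure.restrict_apply_univ, withDensity_apply _ hIm]⟩
  exact (hf.restrict I).integrable one_le_two

/-- The Bellman function at the data of the atom `I`. -/
noncomputable def atomBellman (μ : Measure X) (α : ℝ → ℝ≥0) (u : X → ℝ≥0) (f : X → 𝕜)
    (I : Set X) : ℝ≥0∞ :=
  ENNReal.ofReal (bellman α (∫ x, ((u x : ℝ) : 𝕜) * f x ∂(cond μ I))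
    (∫⁻ x, (u x : ℝ≥0∞) ∂(cond μ I)) (lorentzNorm (cond μ I) u))

/-- The term of an atom `I` of generation `n`, with its martingale difference taken between the
generations `n` and `n + 1`. -/
noncomputable def atomTerm (D : AtomicFiltration μ) (α : ℝ → ℝ≥0) (u : X → ℝ≥0) (f : X → 𝕜)
    (n : ℤ) (I : Set X) : ℝ≥0∞ :=
  (∫⁻ y, ‖∫ x, ((u x : ℝ) : 𝕜) * f x ∂(cond μ (D.cell (n + 1) y)) -
    ∫ x, ((u x : ℝ) : 𝕜) * f x ∂(cond μ I)‖ₑ ∂(cond μ I)) ^ 2 / entropyBump α (cond μ I) u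

variable {α : ℝ → ℝ≥0}

theorem atomBellman_add_atomTerm_le (hα : MonotoneOn α (Ici 1)) (hC : bumpConst α < ∞)
    (hu : Measurable u) (hu_int : ∀ I ∈ D.allAtoms, ∫⁻ x in I, (u x : ℝ≥0∞) ∂μ < ∞)
    (hf : MemLp f 2 (μ.withDensity fun x => (u x : ℝ≥0∞))) {n : ℤ} {I : Set X}
    (hI : I ∈ D.atoms n) :
    atomBellman μ α u f I + D.atomTerm α u f n I ≤
      ∫⁻ y, atomBellman μ α u f (D.cell (n + 1) y) ∂(cond μ I) := by
  have hP := isProbabilityMeasure_cond hI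
  have hn : n ≤ n + 1 := by omega
  have hall : ∀ {k : ℤ} {J : Set X}, J ∈ D.atoms k → J ∈ D.allAtoms := fun h =>
    mem_iUnion.2 ⟨_, h⟩
  have hg := integrableOn_coe_mul hu hI (hu_int I (hall hI)) hf
  have hxm := integral_cond_integral_cond_cell hn hI hg
  -- If `u` has mean zero on `I`, Cauchy–Schwarz makes `fu` vanish almost everywhere there. The
  -- numerator of the term is `0`, so the quotient is `0` even when its denominator is `0`.
  rcases eq_or_ne (∫⁻ x, (u x : ℝ≥0∞) ∂(cond μ I)) 0 with h0 | h0
  · have hx0 := integral_cond_eq_zero hu hI hf.1 h0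
    have e1 : atomBellman μ α u f I = 0 := by
      rw [atomBellman, hx0]
      simp [bellman]
    have e2 : D.atomTerm α u f n I = 0 := by
      have : ∫⁻ y, ‖∫ x, ((u x : ℝ) : 𝕜) * f x ∂(cond μ (D.cell (n + 1) y)) -
          ∫ x, ((u x : ℝ) : 𝕜) * f x ∂(cond μ I)‖ₑ ∂(cond μ I) = 0 := by
        rw [hx0]
        simp only [sub_zero]
        refine le_antisymm ?_ zero_le
        calc _ ≤ ∫⁻ y, ∫⁻ x, ‖((u x : ℝ) : 𝕜) * f x‖ₑ ∂(cond μ (D.cell (n + 1) y)) ∂(cond μ I) :=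
              lintegral_mono fun y => enorm_integral_le_lintegral_enorm _
          _ = ∫⁻ x, ‖((u x : ℝ) : 𝕜) * f x‖ₑ ∂(cond μ I) :=
              lintegral_cond_lintegral_cond_cell hn hI _
          _ ≤ 0 := by
              have := lintegral_enorm_cond_sq_le hu hI hf.1
              rw [h0, mul_zero] at this
              exact (pow_eq_zero_iff two_ne_zero |>.1 (le_antisymm this zero_le)).le
      rw [atomTerm, this]
      simp
    rw [e1, e2, add_zero]
    exact zero_le
  · have hQ : Integrable (fun y =>
        ‖∫ x, ((u x : ℝ) : 𝕜) * f x ∂(cond μ (D.cell (n + 1) y))‖ ^ 2 /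
          (∫⁻ x, (u x : ℝ≥0∞) ∂(cond μ (D.cell (n + 1) y))).toReal) (cond μ I) := by
      refine integrable_cond hI (Integrable.integrableOn ⟨(measurable_comp_cell (n + 1) fun J =>
        ‖∫ x, ((u x : ℝ) : 𝕜) * f x ∂(cond μ J)‖ ^ 2 /
          (∫⁻ x, (u x : ℝ≥0∞) ∂(cond μ J)).toReal).aestronglyMeasurable, ?_⟩)
      rw [hasFiniteIntegral_iff_ofReal (Filter.Eventually.of_forall fun y => by positivity)]
      refine (lintegral_norm_sq_div_cell_le hu (n + 1) hf.1).trans_lt ?_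
      have := (eLpNorm_lt_top_iff_lintegral_rpow_enorm_lt_top two_ne_zero
        ENNReal.ofNat_ne_top).1 hf.2
      simpa using this
    have key := ofReal_bellman_add_le hα hC
      (integrable_cond_integral_cond_cell hn hI hg)
      (measurable_comp_cell (n + 1) fun J => ∫⁻ x, (u x : ℝ≥0∞) ∂(cond μ J))
      (measurable_comp_cell (n + 1) fun J => lorentzNorm (cond μ J) u)
      (fun y => by
        have := isProbabilityMeasure_cond (D.cell_mem_atoms (n + 1) y)
        exact lintegral_le_lorentzNorm hu)
      (Filter.Eventually.of_forall fun y =>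
        integral_cond_eq_zero hu (D.cell_mem_atoms (n + 1) y) hf.1) hQ
      (lintegral_cond_lintegral_cond_cell hn hI _) h0
      (lintegral_cond_ne_top hI (hu_int I (hall hI))) (lintegral_le_lorentzNorm hu)
      (lintegral_lorentzNorm_cell_add_le hn hI hu (hu_int I (hall hI)))
    rw [hxm] at key
    exact key

theorem tsum_atomTerm_le (hα : MonotoneOn α (Ici 1)) (hC : bumpConst α < ∞)
    (hu : Measurable u) (hu_int : ∀ I ∈ D.allAtoms, ∫⁻ x in I, (u x : ℝ≥0∞) ∂μ < ∞)
    (hf : MemLp f 2 (μ.withDensity fun x => (u x : ℝ≥0∞))) :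
    ∑' n, ∑' I : D.atoms n, D.atomTerm α u f n (I : Set X) * μ (I : Set X) ≤
      36 * bumpConst α * eLpNorm f 2 (μ.withDensity fun x => (u x : ℝ≥0∞)) ^ 2 := by
  refine ENNReal.tsum_int_le_of_add_le
    (S := fun n => ∫⁻ y, atomBellman μ α u f (D.cell n y) ∂μ) (fun n => ?_) fun n => ?_
  -- The integral of `B` over generation `n + 1` is cut along the atoms of generation `n`, on each
  -- of which the one-step inequality applies.
  · rw [lintegral_comp_cell, lintegral_eq_tsum_atoms (D := D) n, ← ENNReal.tsum_add]
    refine ENNReal.tsum_le_tsum fun I => ?_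
    rw [← add_mul, mul_comm, ← measure_mul_lintegral_cond I.2]
    gcongr
    exact atomBellman_add_atomTerm_le hα hC hu hu_int hf I.2
  · have hL : eLpNorm f 2 (μ.withDensity fun x => (u x : ℝ≥0∞)) ^ 2 =
        ∫⁻ x, ‖f x‖ₑ ^ 2 ∂(μ.withDensity fun x => (u x : ℝ≥0∞)) := by
      have := eLpNorm_nnreal_pow_eq_lintegral (μ := μ.withDensity fun x => (u x : ℝ≥0∞))
        (f := f) (p := 2) two_ne_zero
      simpa using this
    have hc : ENNReal.ofReal (36 * (bumpConst α).toReal) = 36 * bumpConst α := by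
      rw [ENNReal.ofReal_mul (by norm_num), ENNReal.ofReal_toReal hC.ne]
      simp
    rw [hL]
    refine le_trans ?_ (mul_le_mul_right (lintegral_norm_sq_div_cell_le (D := D) hu n hf.1) _)
    rw [← lintegral_const_mul' _ _ (ENNReal.mul_ne_top (by simp) hC.ne)]
    refine lintegral_mono fun y => ?_
    rw [← hc, ← ENNReal.ofReal_mul (by positivity)]
    exact ENNReal.ofReal_le_ofReal (bellman_le hC _ _ _)

theorem eLpNorm_martingaleDiff_sq_div {n : ℤ} {I : Set X}
    (hI : IsGreatest {k | I ∈ D.atoms k} n) :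
    (eLpNorm (D.martingaleDiff I fun x => ((u x : ℝ) : 𝕜) * f x) 1 (cond μ I)) ^ 2 /
      entropyBump α (cond μ I) u = D.atomTerm α u f n I := by
  rw [atomTerm, eLpNorm_one_eq_lintegral_enorm]
  congr 2
  refine lintegral_congr_ae ?_
  filter_upwards [ae_cond_mem (measurableSet_of_mem_atoms hI.1)] with y hy
  rw [martingaleDiff_eq hI _ hy]

end Weight

end AtomicFiltration

theorem mainTheorem3 {X : Type*} [MeasurableSpace X] (μ : Measure X) [SigmaFinite μ]
    (D : AtomicFiltration μ)
    (α : ℝ → ℝ≥0) (hα : MonotoneOn α (Ici 1)) (hC : bumpConst α < ∞)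
    (u : X → ℝ≥0) (hu : Measurable u)
    (hu_int : ∀ I ∈ D.allAtoms, ∫⁻ x in I, (u x : ℝ≥0∞) ∂μ < ∞)
    {𝕜 : Type*} [RCLike 𝕜] (f : X → 𝕜)
    (hf : MemLp f 2 (μ.withDensity fun x => (u x : ℝ≥0∞))) :
    ∑' I : D.allAtoms,
        (eLpNorm (D.martingaleDiff (I : Set X) fun x => ((u x : ℝ) : 𝕜) * f x) 1
            (ProbabilityTheory.cond μ (I : Set X))) ^ 2 /
          entropyBump α (ProbabilityTheory.cond μ (I : Set X)) u * μ (I : Set X) ≤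
      36 * bumpConst α * (eLpNorm f 2 (μ.withDensity fun x => (u x : ℝ≥0∞))) ^ 2
 := by
  refine le_trans ?_ (D.tsum_atomTerm_le hα hC hu hu_int hf)
  rw [tsum_subtype D.allAtoms fun I : Set X =>
    (eLpNorm (D.martingaleDiff I fun x => ((u x : ℝ) : 𝕜) * f x) 1
      (ProbabilityTheory.cond μ I)) ^ 2 / entropyBump α (ProbabilityTheory.cond μ I) u * μ I]
  simp_rw [fun n => tsum_subtype (D.atoms n) fun I : Set X => D.atomTerm α u f n I * μ I]
  rw [ENNReal.tsum_comm]
  refine ENNReal.tsum_le_tsum fun I => ?_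
  by_cases hI : I ∈ D.allAtoms
  · rw [indicator_of_mem hI]
    -- In the double sum over generations `I` may occur many times; only its last generation is
    -- kept, where the next cells are its children. If there is no last one, `Δ_I` vanishes.
    by_cases hn : ∃ n, IsGreatest {k | I ∈ D.atoms k} n
    · obtain ⟨n, hn⟩ := hn
      refine le_trans (le_of_eq ?_) (ENNReal.le_tsum n)
      rw [indicator_of_mem (show I ∈ D.atoms n from hn.1),
        AtomicFiltration.eLpNorm_martingaleDiff_sq_div hn]
    · rw [AtomicFiltration.martingaleDiff_eq_zero hI hn]
      simp
  · rw [indicator_of_notMem hI]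
    exact zero_le
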